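/- Let $F=F_{a,b}$ be the free group on $a,b$, $S=\{a^{\pm1},b^{\pm1}\}$, $|g|$ the word length, $\Sigma=S^{\mathbb Z}$ the two-sided full shift, and for a word $w=w_1\cdots w_n$ in $S$ let $\underline{\mathfrak s}(w)\in F$ be the product $w_1\cdots w_n$. For $A,B\in S$ let $\mathcal W^{A,B}_n$ be the set of words of length $n\ge 1$ with first letter $A$ and last letter $B$; every word of length $n$ has weight $R_n(w)=4^{-n}$. Let $\lambda$ be the left regular representation of $F$ on $\ell^2(F)$ and $\delta_e$ the indicator of the identity. Fix letters $A,\alpha\in S$. For $c:\mathbb N\to(0,\infty)$, $t>0$ and $N\ge1$ put $$\phi_{c;\le N}[t](g)=\sum_{n=1}^N t^{-n}c_n\sum_{w\in\mathcal W_n^{A,\alpha},\ \underline{\mathfrak s}(w)=g}R_n(w),$$ $$\gamma=\inf\Bigl\{t>0:\sup_N\sum_{h}\langle\lambda(h)\delta_e,\delta_e\rangle\,\phi_{1;\le N}[t](h)<\infty\Bigr\},\qquad F_c[t]=\lim_{N\to\infty}\langle\phi_{c;\le N}[t]*\phi_{c;\le N}[t]*\delta_e,\delta_e\rangle .$$ Assume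 that $c$ is slowly increasing (positive, nondecreasing, $c_{n+1}/c_n\to1$) and that $F_c[t]\to\infty$ and $F_c[t]\big/\lim_N\langle\phi_{c;\le N}[t]*\delta_e,\delta_e\rangle\to\infty$ as $t\downarrow\gamma$. Fix $X\in S^{\mathbb Z_{<0}}$ and $x\in S^{\mathbb Z_{\ge0}}$ such that $x_i=A$ exactly for $i=0$ and $X_i=\alpha$ exactly for $i=-1$. For $t>\gamma$ let $\mu_{c;N}[t]$ be the measure on $\Sigma$ $$\mu_{c;N}[t]=\sum_{B,b\in S}\ \sum_{n,m=1}^N t^{-n}c_n\,t^{-m}c_m\sum_{v\in\mathcal W_n^{b,\alpha}}\ \sum_{u\in\mathcal W_m^{A,B}}R_n(v)R_m(u)\,\frac{\langle\lambda(\underline{\mathfrak s}(u)\underline{\mathfrak s}(v))\delta_e,\delta_e\rangle}{F_c[t]}\,D(Xu.vx),$$ where $D(y)$ is the Dirac mass at $y$, and in $Xu.vx$ the word $u$ occupies the coordinates $-m,\dots,-1$ and $v$ the coordinates $0,\dots,n-1$. Let $\mu_c[t]$ be the weak limit of $\mu_{c;N}[t]$ as $N\to\infty$. A twisted measure $\mu_c^\phi$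 is any finite measure on $\Sigma$ that is the weak limit of $\mu_c[t_k]$ for some sequence $t_k>\gamma$ with $t_k\to\gamma$. Then, for all such $A,\alpha,c,X,x$ and every such twisted measure $\mu_c^\phi$, $\mu_c^\phi$-almost every $y\in\Sigma$ satisfies $$\limsup_{n\to\infty}\frac1n\bigl|\underline{\mathfrak s}(y_{-n}\cdots y_{-1})\bigr|\le\frac{2\log2-\log3}{\log3}<\frac12 .$$ Here $\frac12$ is the drift of the simple random walk: if $\mu$ is the product measure on $\Sigma$ whose coordinates are independent and uniform on $S$, then $\frac1n|\underline{\mathfrak s}(y_{-n}\cdots y_{-1})|\to\frac12$ for $\mu$-almost every $y$. -/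

import Mathlib

open MeasureTheory Filter Topology
open scoped BigOperators

noncomputable section

namespace FreeWalk

/-! ### The random walk extension over the full shift -/

/-- The free group on two generators. -/
abbrev F2 : Type := FreeGroup (Fin 2)

/-- The four letters `a, a⁻¹, b, b⁻¹`: a generator together with a sign (`true` for the generator,
`false` for its inverse). -/
abbrev Letter : Type := Fin 2 × Bool

/-- The two-sided full shift on the four letters, with its product topology and product
`σ`-algebra. -/
abbrev Shift : Type := ℤ → Letter

/-- The group element represented by a letter. -/
def skew (l : Letter) : F2 := FreeGroup.mk [l]

/-- The step distribution of the simple random walk. -/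
def stepProb (_ : Letter) : ℝ := 1 / 4

/-- The product in the group of the letters of a finite word, from left to right. -/
def wordProd {n : ℕ} (w : Fin n → Letter) : F2 := (List.ofFn fun i => skew (w i)).prod

/-- The weight `R_n(w x) = p(w_1) ⋯ p(w_n)` of a word of length `n`. -/
def wordWeight {n : ℕ} (w : Fin n → Letter) : ℝ := ∏ i, stepProb (w i)

/-- The words of length `n` with first letter `A` and last letter `a`
(there are none of length zero). -/
def words (n : ℕ) (A a : Letter) : Finset (Fin n → Letter) :=
  Finset.univ.filter fun w =>
    (List.ofFn w).head? = some A ∧ (List.ofFn w).getLast? = some a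

/-! ### The left regular representation -/

/-- The real Hilbert space `ℓ²(F2)`. -/
abbrev EllTwo : Type := lp (fun _ : F2 => ℝ) 2

/-- The left regular representation, `(λ(g) f)(x) = f(g⁻¹ x)`. -/
def leftRegular (g : F2) (f : EllTwo) : EllTwo :=
  ⟨fun x => f (g⁻¹ * x), by
    have hf := lp.memℓp f
    have h2 : 0 < (2 : ENNReal).toReal := by norm_num
    rw [memℓp_gen_iff h2] at hf
    apply memℓp_gen
    exact (Equiv.mulLeft g⁻¹).summable_iff.mpr hf⟩

/-- The indicator function of the identity, as a vector of `ℓ²(F2)`. -/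
def deltaOne : EllTwo := lp.single 2 (1 : F2) (1 : ℝ)

/-- The diagonal matrix coefficient `h ↦ ⟨λ(h) δ_e, δ_e⟩`. -/
def matrixCoeff (h : F2) : ℝ := inner ℝ (leftRegular h deltaOne) deltaOne

/-- The integral of the matrix coefficient against a density `φ` on the group,
that is `⟨φ ∗ δ_e, δ_e⟩`; it is applied only to finitely supported `φ`. -/
def integrate (φ : F2 → ℝ) : ℝ := ∑' h, φ h * matrixCoeff h

/-- Convolution of functions on the group; it is applied only to finitely supported functions. -/
def conv (φ ψ : F2 → ℝ) (g : F2) : ℝ := ∑' h, φ h * ψ (h⁻¹ * g)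

/-! ### Thermodynamic densities -/

/-- The partial sum, over word lengths `1 ≤ n ≤ N`, of the thermodynamic density with end letters
`A, a`, weights `c` and parameter `t`. -/
def density (A a : Letter) (c : ℕ → ℝ) (N : ℕ) (t : ℝ) (g : F2) : ℝ :=
  ∑ n ∈ Finset.Icc 1 N, (t ^ n)⁻¹ * c n *
    ∑ w ∈ (words n A a).filter (fun w => wordProd w = g), wordWeight w

/-- The convergence parameter `γ(δ_e)`. -/
def criticalParam (A a : Letter) : ℝ :=
  sInf {t : ℝ | 0 < t ∧
    BddAbove (Set.range fun N : ℕ => integrate (density A a (fun _ => 1) N t))}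

/-- `⟨φ_c[t] ∗ δ_e, δ_e⟩`: the supremum, hence the limit, of a sequence that is nondecreasing in
the truncation `N` and bounded for `t` above the convergence parameter. -/
def singleSeries (A a : Letter) (c : ℕ → ℝ) (t : ℝ) : ℝ :=
  ⨆ N : ℕ, integrate (density A a c N t)

/-- The normalising factor `lim_N ⟨φ_{c;≤N}[t] ∗ φ_{c;≤N}[t] ∗ δ_e, δ_e⟩`: again the supremum of a
sequence that is nondecreasing in `N` and bounded for `t` above the convergence parameter. -/
def normFactor (A a : Letter) (c : ℕ → ℝ) (t : ℝ) : ℝ :=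
  ⨆ N : ℕ, integrate (conv (density A a c N t) (density A a c N t))

/-- Slowly increasing weights. -/
structure SlowlyIncreasing (c : ℕ → ℝ) : Prop where
  pos : ∀ n, 0 < c n
  mono : Monotone c
  ratio : Tendsto (fun n => c (n + 1) / c n) atTop (𝓝 1)

/-- The weights `c` used in the construction: slowly increasing, with the normalising factor
diverging at the convergence parameter, and faster than `⟨φ_c[t] ∗ δ_e, δ_e⟩`. -/
structure Admissible (A a : Letter) (c : ℕ → ℝ) : Prop where
  slow : SlowlyIncreasing c
  diverges : Tendsto (fun t => normFactor A a c t) (𝓝[>] criticalParam A a) atTop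
  dominates : Tendsto (fun t => normFactor A a c t / singleSeries A a c t)
    (𝓝[>] criticalParam A a) atTop

/-! ### Twisted measures -/

/-- The reference sequence `z = X.x`: among the coordinates `i ≥ 0` the letter `A` occurs exactly
at `i = 0`, and among the coordinates `i < 0` the letter `a` occurs exactly at `i = -1`. -/
def IsReference (A a : Letter) (z : Shift) : Prop :=
  (∀ i : ℤ, 0 ≤ i → (z i = A ↔ i = 0)) ∧ (∀ i : ℤ, i < 0 → (z i = a ↔ i = -1))

/-- The two-sided sequence `X u . v x`, where `z = X.x`: the word `u` occupies the coordinates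
`-m, …, -1` and the word `v` the coordinates `0, …, n - 1`. -/
def insertWords {m n : ℕ} (z : Shift) (u : Fin m → Letter) (v : Fin n → Letter) : Shift :=
  fun i =>
    if i < -(m : ℤ) then z (i + m)
    else if h : i < 0 ∧ 0 ≤ i + (m : ℤ) then u ⟨(i + m).toNat, by omega⟩
    else if h : 0 ≤ i ∧ i < (n : ℤ) then v ⟨i.toNat, by omega⟩
    else z (i - n)

/-- The Dirac mass at a sequence, as a finite measure. -/
def diracMass (y : Shift) : FiniteMeasure Shift := ⟨Measure.dirac y, inferInstance⟩

/-- The approximating measure at truncation `N` and parameter `t`: a finite sum of weighted Dirac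
masses at the sequences `X u . v x`. -/
def approxMeasure (A a : Letter) (c : ℕ → ℝ) (z : Shift) (N : ℕ) (t : ℝ) : FiniteMeasure Shift :=
  ∑ B : Letter, ∑ b : Letter, ∑ n ∈ Finset.Icc 1 N, ∑ m ∈ Finset.Icc 1 N,
    ∑ v ∈ words n b a, ∑ u ∈ words m A B,
      Real.toNNReal ((t ^ n)⁻¹ * c n * ((t ^ m)⁻¹ * c m) * wordWeight v * wordWeight u *
          matrixCoeff (wordProd u * wordProd v) / normFactor A a c t) •
        diracMass (insertWords z u v)

/-- `μ` is a twisted measure for the letters `A, a`, weights `c` and reference sequence `z`: it is a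
weak limit, along some parameters `t_k` above the convergence parameter and tending to it, of the measures `ν_k`, each of which is the weak limit, as `N → ∞`, of
the approximating measures with parameter `t_k`. -/
def IsTwistedMeasure (A a : Letter) (c : ℕ → ℝ) (z : Shift) (μ : FiniteMeasure Shift) : Prop :=
  Admissible A a c ∧ IsReference A a z ∧
    ∃ (t : ℕ → ℝ) (ν : ℕ → FiniteMeasure Shift),
      (∀ k, criticalParam A a < t k) ∧ Tendsto t atTop (𝓝 (criticalParam A a)) ∧
      (∀ k, Tendsto (fun N => approxMeasure A a c z N (t k)) atTop (𝓝 (ν k))) ∧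
      Tendsto ν atTop (𝓝 μ)

/-- The equilibrium state of the simple random walk: the coordinates are independent and uniformly
distributed on the four letters. -/
def walkMeasure : Measure Shift :=
  Measure.infinitePi fun _ : ℤ => (PMF.uniformOfFintype Letter).toMeasure

/-- The group element `s(x_{-n} ⋯ x_{-1})`. -/
def backwardProd (x : Shift) (n : ℕ) : F2 :=
  wordProd fun i : Fin n => x ((i : ℤ) - n)

end FreeWalk

end

open FreeWalk

noncomputable section

namespace FreeWalk

/-! In a twisted measure, fix the last `ℓ` letters `w` of the word `u`. The constraint that `u` and
`v` close up turns the mass of this pattern into an autocorrelation `∑ φ(g) φ(g s(w))`, where `φ` is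
the density of all words without constraint on end letters. Two estimates control the sum over the
`w` with `|s(w)| = k`. At most `4^ℓ 3^{-k}` words have a given such product (`wordCount_le`), and
convolution with the sphere of radius `k` has quadratic form at most `4 (k+1) 3^{k/2}`
(`sum_sphere_mul_le`, a Schur test with weight `3^{-|g|/2}`). Summing over `k ≥ q` leaves `4^ℓ
3^{-q/2}` up to a polynomial in `ℓ`.

The density `φ` is symmetric and, since any word can be capped to have prescribed end letters, its
`ℓ²` norm squared is at most a constant times the normalising factor. Together with the weight
`(4t)^{-ℓ}` of the `ℓ` extra letters, the event `|s(w)| ≥ q` has mass at most `C (ℓ+1)² t^{-ℓ}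
3^{-q/2}`. Short `u`, where slow growth of `c` is not yet effective, contribute a multiple of the
single series, negligible by the domination assumption.

Finally `γ ≥ √3/2` (Dirichlet eigenfunctions on balls), so with `q = βℓ` the bound is exponentially
small as soon as `β` exceeds `(2 log 2 - log 3)/log 3`, and Borel–Cantelli concludes. The drift
`1/2` of the uniform measure comes from a Chernoff bound with explicit supersolutions. -/

/-! ### Letters and word length -/

/-- The inverse letter. -/
def Letter.inv (l : Letter) : Letter := (l.1, !l.2)

@[simp] lemma Letter.inv_inv (l : Letter) : Letter.inv (Letter.inv l) = l := by
  simp [Letter.inv]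

lemma skew_inv (l : Letter) : skew (Letter.inv l) = (skew l)⁻¹ := by
  simp [skew, Letter.inv, FreeGroup.inv_mk, FreeGroup.invRev]

@[simp] lemma norm_skew (l : Letter) : (skew l).norm = 1 := by
  simp [skew, FreeGroup.norm, FreeGroup.toWord_mk]

/-- The word of `g` is already reduced, so a prepended letter can cause at most one cancellation, at
the head. -/
lemma toWord_skew_mul (l : Letter) (g : F2) :
    (skew l * g).toWord = if g.toWord.head? = some (Letter.inv l) then g.toWord.tail
      else l :: g.toWord := by
  have h : (skew l * g).toWord = FreeGroup.reduce (l :: g.toWord) := by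
    conv_lhs => rw [← FreeGroup.mk_toWord (x := g)]
    simp [skew, FreeGroup.toWord_mk, FreeGroup.mul_mk]
  rw [h, FreeGroup.reduce.cons, FreeGroup.reduce_toWord]
  rcases hg : g.toWord with _ | ⟨x, xs⟩
  · simp
  · obtain ⟨i, b⟩ := x
    obtain ⟨j, b'⟩ := l
    have : ((i, b) = Letter.inv (j, b')) ↔ (j = i ∧ b' = !b) := by
      simp only [Letter.inv, Prod.mk.injEq]
      cases b <;> cases b' <;> simp [eq_comm]
    simp [this]

lemma norm_skew_mul_of_head (l : Letter) (g : F2) (h : g.toWord.head? = some (Letter.inv l)) :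
    (skew l * g).norm + 1 = g.norm := by
  rw [FreeGroup.norm, FreeGroup.norm, toWord_skew_mul, if_pos h]
  rcases hg : g.toWord with _ | ⟨x, xs⟩
  · simp [hg] at h
  · simp

lemma norm_skew_mul_of_head_ne (l : Letter) (g : F2)
    (h : g.toWord.head? ≠ some (Letter.inv l)) : (skew l * g).norm = g.norm + 1 := by
  rw [FreeGroup.norm, FreeGroup.norm, toWord_skew_mul, if_neg h]
  simp

lemma mul_skew_inv (g : F2) (l : Letter) : (g * skew l)⁻¹ = skew (Letter.inv l) * g⁻¹ := by
  rw [skew_inv, mul_inv_rev]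

lemma norm_mul_skew_of_head (g : F2) (l : Letter) (h : g⁻¹.toWord.head? = some l) :
    (g * skew l).norm + 1 = g.norm := by
  rw [← FreeGroup.norm_inv_eq, mul_skew_inv, ← FreeGroup.norm_inv_eq (x := g)]
  exact norm_skew_mul_of_head _ _ (by simpa using h)

lemma norm_mul_skew_of_head_ne (g : F2) (l : Letter) (h : g⁻¹.toWord.head? ≠ some l) :
    (g * skew l).norm = g.norm + 1 := by
  rw [← FreeGroup.norm_inv_eq, mul_skew_inv, ← FreeGroup.norm_inv_eq (x := g)]
  exact norm_skew_mul_of_head_ne _ _ (by simpa using h)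

/-- The head of `g⁻¹` encodes the last letter of `g`. After a step without cancellation, only the
inverse of the letter just appended can cancel next. -/
lemma head_mul_skew_inv (g : F2) (l : Letter) (h : g⁻¹.toWord.head? ≠ some l) :
    (g * skew l)⁻¹.toWord.head? = some (Letter.inv l) := by
  rw [mul_skew_inv, toWord_skew_mul, if_neg (by simpa using h)]
  simp

/-- The sum over the neighbours of `g ≠ 1` of a radial function. -/
lemma sum_norm_skew_mul {g : F2} (hg : g ≠ 1) (f : ℕ → ℝ) :
    ∑ l, f (skew l * g).norm = f (g.norm - 1) + 3 * f (g.norm + 1) := by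
  rcases hw : g.toWord with _ | ⟨x, xs⟩
  · exact absurd (FreeGroup.toWord_eq_nil_iff.mp hw) hg
  rw [← Finset.add_sum_erase _ _ (Finset.mem_univ (Letter.inv x))]
  congr 1
  · have := norm_skew_mul_of_head (Letter.inv x) g (by simp [hw])
    rw [← this, Nat.add_sub_cancel]
  · rw [Finset.sum_congr rfl (g := fun _ => f (g.norm + 1))]
    · simp [Finset.card_erase_of_mem]
    · intro l hl
      rw [norm_skew_mul_of_head_ne]
      rw [hw]
      intro h
      simp only [List.head?_cons, Option.some.injEq] at h
      exact (Finset.ne_of_mem_erase hl) (by simp [h])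

lemma sum_norm_skew_mul_one (f : ℕ → ℝ) : ∑ l, f (skew l * 1).norm = 4 * f 1 := by
  simp

/-! ### Sums over words -/

lemma wordProd_zero (w : Fin 0 → Letter) : wordProd w = 1 := by simp [wordProd]

lemma wordProd_cons {n : ℕ} (l : Letter) (w : Fin n → Letter) :
    wordProd (Fin.cons l w : Fin (n + 1) → Letter) = skew l * wordProd w := by
  simp [wordProd, List.ofFn_succ]

lemma wordProd_append {m n : ℕ} (u : Fin m → Letter) (v : Fin n → Letter) :
    wordProd (Fin.append u v) = wordProd u * wordProd v := by
  have : (fun i => skew (Fin.append u v i)) =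
      Fin.append (fun i => skew (u i)) (fun i => skew (v i)) := by
    ext i
    refine Fin.addCases (fun i => ?_) (fun i => ?_) i <;> simp
  rw [wordProd, this, List.ofFn_fin_append, List.prod_append]
  rfl

lemma wordWeight_eq {n : ℕ} (w : Fin n → Letter) : wordWeight w = (1 / 4) ^ n := by
  simp [wordWeight, stepProb]

lemma sum_cons {n : ℕ} (f : (Fin (n + 1) → Letter) → ℝ) :
    ∑ w, f w = ∑ l, ∑ w : Fin n → Letter, f (Fin.cons l w) := by
  rw [← (Fin.consEquiv fun _ : Fin (n + 1) => Letter).sum_comp, Fintype.sum_prod_type]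
  rfl

lemma sum_append {m n : ℕ} (f : (Fin (m + n) → Letter) → ℝ) :
    ∑ w, f w = ∑ u : Fin m → Letter, ∑ v : Fin n → Letter, f (Fin.append u v) := by
  rw [← (Fin.appendEquiv m n).sum_comp, Fintype.sum_prod_type]
  rfl

/-- A supersolution of the walk bounds its expectations. -/
lemma sum_wordProd_le {u : F2 → ℝ} {lam : ℝ} (hlam : 0 ≤ lam)
    (hu : ∀ g, ∑ l, u (skew l * g) ≤ lam * u g) (n : ℕ) (g : F2) :
    ∑ w : Fin n → Letter, u (wordProd w * g) ≤ lam ^ n * u g := by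
  induction n with
  | zero => simp [wordProd_zero]
  | succ n ih =>
    rw [sum_cons, Finset.sum_comm]
    calc _ = ∑ w : Fin n → Letter, ∑ l, u (skew l * (wordProd w * g)) := by
          simp [wordProd_cons, mul_assoc]
      _ ≤ ∑ w : Fin n → Letter, lam * u (wordProd w * g) := Finset.sum_le_sum fun w _ => hu _
      _ ≤ lam * (lam ^ n * u g) := by
          rw [← Finset.mul_sum]; exact mul_le_mul_of_nonneg_left ih hlam
      _ = _ := by ring

/-- A subsolution of the walk bounds its expectations from below. -/
lemma le_sum_wordProd {u : F2 → ℝ} {lam : ℝ} (hlam : 0 ≤ lam)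
    (hu : ∀ g, lam * u g ≤ ∑ l, u (skew l * g)) (n : ℕ) (g : F2) :
    lam ^ n * u g ≤ ∑ w : Fin n → Letter, u (wordProd w * g) := by
  induction n with
  | zero => simp [wordProd_zero]
  | succ n ih =>
    rw [sum_cons, Finset.sum_comm]
    calc lam ^ (n + 1) * u g = lam * (lam ^ n * u g) := by ring
      _ ≤ ∑ w : Fin n → Letter, lam * u (wordProd w * g) := by
          rw [← Finset.mul_sum]; exact mul_le_mul_of_nonneg_left ih hlam
      _ ≤ ∑ w : Fin n → Letter, ∑ l, u (skew l * (wordProd w * g)) :=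
          Finset.sum_le_sum fun w _ => hu _
      _ = _ := by simp [wordProd_cons, mul_assoc]

/-- The number of words of length `n` with product `g`. -/
def wordCount (n : ℕ) (g : F2) : ℝ :=
  ((Finset.univ.filter fun w : Fin n → Letter => wordProd w = g).card : ℝ)

lemma wordCount_eq_sum (n : ℕ) (g : F2) :
    wordCount n g = ∑ w : Fin n → Letter, if wordProd w = g then (1 : ℝ) else 0 := by
  simp [wordCount]

lemma wordCount_nonneg (n : ℕ) (g : F2) : 0 ≤ wordCount n g := Nat.cast_nonneg _

/-- The function `3^{-|g|}` is harmonic off the identity and superharmonic at it. Start the walk at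
`g⁻¹`: each word with product `g` ends at the identity, where the function is `1`. -/
lemma wordCount_le (n : ℕ) (g : F2) : wordCount n g ≤ 4 ^ n * (1 / 3) ^ g.norm := by
  have key : ∀ g : F2, ∑ l, (1 / 3 : ℝ) ^ (skew l * g).norm ≤ 4 * (1 / 3) ^ g.norm := by
    intro g
    by_cases hg : g = 1
    · subst hg
      simp
      norm_num
    · rw [sum_norm_skew_mul hg fun k => (1 / 3 : ℝ) ^ k]
      have : g.norm ≠ 0 := fun h => hg (FreeGroup.norm_eq_zero.mp h)
      obtain ⟨k, hk⟩ := Nat.exists_eq_succ_of_ne_zero this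
      rw [hk]
      simp only [Nat.succ_eq_add_one, Nat.add_sub_cancel, pow_succ]
      apply le_of_eq; ring
  have h := sum_wordProd_le (u := fun g => (1 / 3 : ℝ) ^ g.norm) (by norm_num) key n g⁻¹
  rw [FreeGroup.norm_inv_eq] at h
  refine le_trans ?_ h
  rw [wordCount_eq_sum]
  refine Finset.sum_le_sum fun w _ => ?_
  split_ifs with hw
  · simp [hw]
  · positivity

/-- The formal inverse of a word. -/
def invWord {n : ℕ} (w : Fin n → Letter) : Fin n → Letter := fun i => Letter.inv (w i.rev)

lemma wordProd_invWord {n : ℕ} (w : Fin n → Letter) : wordProd (invWord w) = (wordProd w)⁻¹ := by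
  rw [wordProd, wordProd, List.prod_inv_reverse]
  congr 1
  apply List.ext_getElem
  · simp
  · intro i h1 h2
    simp only [List.length_ofFn] at h1
    simp only [List.getElem_ofFn, List.getElem_reverse, List.getElem_map, List.length_map,
      List.length_ofFn, invWord, skew_inv]
    congr 3
    ext
    simp
    omega

lemma invWord_invWord {n : ℕ} (w : Fin n → Letter) : invWord (invWord w) = w := by
  ext i <;> simp [invWord]

lemma wordCount_inv (n : ℕ) (g : F2) : wordCount n g⁻¹ = wordCount n g := by
  rw [wordCount, wordCount]
  congr 1
  refine Finset.card_bij' (fun w _ => invWord w) (fun w _ => invWord w) ?_ ?_ ?_ ?_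
  · intro w hw
    simp only [Finset.mem_filter, Finset.mem_univ, true_and] at hw ⊢
    rw [wordProd_invWord, hw, inv_inv]
  · intro w hw
    simp only [Finset.mem_filter, Finset.mem_univ, true_and] at hw ⊢
    rw [wordProd_invWord, hw]
  · intro w _; exact invWord_invWord w
  · intro w _; exact invWord_invWord w

lemma norm_wordProd_le {n : ℕ} (w : Fin n → Letter) : (wordProd w).norm ≤ n := by
  induction n with
  | zero => simp [wordProd_zero]
  | succ n ih =>
    rw [← Fin.cons_self_tail w, wordProd_cons]
    refine (FreeGroup.norm_mul_le _ _).trans ?_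
    have := ih (Fin.tail w)
    rw [norm_skew]; omega

/-- Every group element is represented by a word of its length. -/
lemma exists_wordProd (g : F2) : ∃ w : Fin g.norm → Letter, wordProd w = g := by
  refine ⟨fun i => g.toWord[(i : ℕ)]'i.2, ?_⟩
  have h : ∀ L : List Letter, (L.map skew).prod = FreeGroup.mk L := by
    intro L
    induction L with
    | nil => rfl
    | cons x xs ih => rw [List.map_cons, List.prod_cons, ih, skew, FreeGroup.mul_mk]; rfl
  conv_rhs => rw [← FreeGroup.mk_toWord (x := g), ← h]
  rw [wordProd]
  congr 1
  apply List.ext_getElem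
  · simp [FreeGroup.norm]
  · intro i h1 h2
    simp only [List.getElem_ofFn, List.getElem_map]
    rfl

/-! ### Norm bound for convolution with spheres -/

/-- The words of length `k` which stay reduced when preceded by the letter `l`. -/
def reducedAfter : ℕ → Letter → Finset (List Letter)
  | 0, _ => {[]}
  | k + 1, l => (Finset.univ.erase (Letter.inv l)).biUnion
      fun x => (reducedAfter k x).image (List.cons x)

lemma mem_reducedAfter (L : List Letter) (l : Letter) (h : FreeGroup.IsReduced (l :: L)) :
    L ∈ reducedAfter L.length l := by
  induction L generalizing l with
  | nil => simp [reducedAfter]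
  | cons x xs ih =>
    rw [FreeGroup.isReduced_cons_cons] at h
    simp only [List.length_cons, reducedAfter, Finset.mem_biUnion, Finset.mem_image]
    refine ⟨x, ?_, xs, ih x h.2, rfl⟩
    rw [Finset.mem_erase]
    refine ⟨?_, Finset.mem_univ _⟩
    rintro rfl
    have := h.1
    simp [Letter.inv] at this

/-- The weight `3^{-|g|/2}`. -/
def radialWeight (g : F2) : ℝ := (√3)⁻¹ ^ g.norm

lemma radialWeight_pos (g : F2) : 0 < radialWeight g := by
  unfold radialWeight; positivity

/-- An inequality suffices for upper bounds and spares any disjointness proof. -/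
lemma sum_biUnion_le {ι κ : Type*} [DecidableEq κ] (s : Finset ι) (t : ι → Finset κ) (f : κ → ℝ)
    (hf : ∀ x, 0 ≤ f x) : ∑ x ∈ s.biUnion t, f x ≤ ∑ i ∈ s, ∑ x ∈ t i, f x := by
  classical
  induction s using Finset.induction_on with
  | empty => simp
  | insert a s ha ih =>
    rw [Finset.biUnion_insert, Finset.sum_insert ha]
    have := Finset.sum_union_inter (s₁ := t a) (s₂ := s.biUnion t) (f := f)
    have h2 : 0 ≤ ∑ x ∈ t a ∩ s.biUnion t, f x := Finset.sum_nonneg fun x _ => hf x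
    linarith

lemma sum_image_le {ι κ : Type*} [DecidableEq κ] (s : Finset ι) (e : ι → κ) (f : κ → ℝ)
    (hf : ∀ x, 0 ≤ f x) : ∑ x ∈ s.image e, f x ≤ ∑ i ∈ s, f (e i) := by
  classical
  have := sum_biUnion_le s (fun i => {e i}) f hf
  simpa [Finset.biUnion_singleton] using this

lemma sum_reducedAfter_succ_le (k : ℕ) (l : Letter) (g : F2) :
    ∑ L ∈ reducedAfter (k + 1) l, radialWeight (g * FreeGroup.mk L) ≤
      ∑ x ∈ Finset.univ.erase (Letter.inv l),
        ∑ L ∈ reducedAfter k x, radialWeight (g * skew x * FreeGroup.mk L) := by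
  refine (sum_biUnion_le _ _ _ fun L => (radialWeight_pos _).le).trans ?_
  refine Finset.sum_le_sum fun x _ => ?_
  refine (sum_image_le _ _ _ fun L => (radialWeight_pos _).le).trans ?_
  refine Finset.sum_le_sum fun L _ => ?_
  rw [mul_assoc, skew, FreeGroup.mul_mk]
  rfl

lemma radialWeight_mul_skew_of_ne (g : F2) (x : Letter) (h : g⁻¹.toWord.head? ≠ some x) :
    radialWeight (g * skew x) = (√3)⁻¹ * radialWeight g := by
  rw [radialWeight, norm_mul_skew_of_head_ne g x h, pow_succ, mul_comm]; rfl

lemma radialWeight_mul_skew_of_eq (g : F2) (x : Letter) (h : g⁻¹.toWord.head? = some x) :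
    radialWeight (g * skew x) = √3 * radialWeight g := by
  rw [radialWeight, radialWeight, ← norm_mul_skew_of_head g x h, pow_succ]
  have : √3 ≠ 0 := by positivity
  field_simp

lemma sqrt_three_mul : (3 : ℝ) * (√3)⁻¹ = √3 := by
  have : (0 : ℝ) < √3 := by positivity
  field_simp
  exact (Real.sq_sqrt (by norm_num)).symm

lemma card_erase_letter (l : Letter) : (((Finset.univ : Finset Letter).erase l).card : ℝ) = 3 := by
  simp [Finset.card_erase_of_mem]

/-- Without cancellation, the weights over the words of length `k` sum to `3^{k/2}`. -/
lemma sum_reducedAfter_le_of_head (k : ℕ) (l : Letter) (g : F2)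
    (h : g⁻¹.toWord.head? = some (Letter.inv l)) :
    ∑ L ∈ reducedAfter k l, radialWeight (g * FreeGroup.mk L) ≤ √3 ^ k * radialWeight g := by
  induction k generalizing l g with
  | zero => simp [reducedAfter, ← FreeGroup.one_eq_mk]
  | succ k ih =>
    refine (sum_reducedAfter_succ_le k l g).trans ?_
    calc _ ≤ ∑ x ∈ Finset.univ.erase (Letter.inv l), √3 ^ k * ((√3)⁻¹ * radialWeight g) := by
          refine Finset.sum_le_sum fun x hx => ?_
          have hne : g⁻¹.toWord.head? ≠ some x := by
            rw [h]; intro hh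
            exact (Finset.ne_of_mem_erase hx) (Option.some.inj hh).symm
          rw [← radialWeight_mul_skew_of_ne g x hne]
          exact ih x _ (head_mul_skew_inv g x hne)
      _ = √3 ^ k * (3 * (√3)⁻¹) * radialWeight g := by
          rw [Finset.sum_const, nsmul_eq_mul, card_erase_letter]; ring
      _ = _ := by rw [sqrt_three_mul, pow_succ]

/-- At most one first letter cancels against the end of `g`; that branch gains `√3` and recurses.
All other branches never cancel again and together cost `√3 ^ (k + 1)`. Hence the factor grows only
linearly in `k`. -/
lemma sum_reducedAfter_le (k : ℕ) (l : Letter) (g : F2) :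
    ∑ L ∈ reducedAfter k l, radialWeight (g * FreeGroup.mk L) ≤
      (k + 1) * √3 ^ k * radialWeight g := by
  induction k generalizing l g with
  | zero => simp [reducedAfter, ← FreeGroup.one_eq_mk]
  | succ k ih =>
    refine (sum_reducedAfter_succ_le k l g).trans ?_
    have hw := radialWeight_pos g
    have h3 : (0 : ℝ) < √3 := by positivity
    calc _ ≤ ∑ x ∈ Finset.univ.erase (Letter.inv l), (√3 ^ k * ((√3)⁻¹ * radialWeight g) +
            if g⁻¹.toWord.head? = some x then (k + 1) * √3 ^ k * (√3 * radialWeight g) else 0) := by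
          refine Finset.sum_le_sum fun x hx => ?_
          split_ifs with hh
          · refine (ih x (g * skew x)).trans ?_
            rw [radialWeight_mul_skew_of_eq g x hh]
            have : 0 ≤ √3 ^ k * ((√3)⁻¹ * radialWeight g) := by positivity
            linarith
          · rw [add_zero, ← radialWeight_mul_skew_of_ne g x hh]
            exact sum_reducedAfter_le_of_head k x _ (head_mul_skew_inv g x hh)
      _ ≤ √3 ^ k * (3 * (√3)⁻¹) * radialWeight g + (k + 1) * √3 ^ k * (√3 * radialWeight g) := by
          rw [Finset.sum_add_distrib, Finset.sum_const, nsmul_eq_mul, card_erase_letter]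
          refine add_le_add (le_of_eq (by ring)) ?_
          refine (Finset.sum_le_univ_sum_of_nonneg fun x => ?_).trans ?_
          · split_ifs <;> positivity
          · rcases g⁻¹.toWord.head? with _ | y
            · simp; positivity
            · simp
      _ = _ := by rw [sqrt_three_mul, pow_succ]; push_cast; ring

/-- The weights over elements `g h`, with `h` in the sphere of radius `k`. -/
lemma sum_sphere_le (k : ℕ) (H : Finset F2) (hH : ∀ h ∈ H, h.norm = k) (g : F2) :
    ∑ h ∈ H, radialWeight (g * h) ≤ 4 * ((k + 1) * √3 ^ k) * radialWeight g := by
  classical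
  have hsub : H ⊆ (Finset.univ : Finset Letter).biUnion
      fun l => (reducedAfter k l).image (FreeGroup.mk : List Letter → F2) := by
    intro h hh
    have hr : FreeGroup.IsReduced h.toWord := FreeGroup.isReduced_toWord
    have hl : h.toWord.length = k := hH h hh
    simp only [Finset.mem_biUnion, Finset.mem_image, Finset.mem_univ, true_and]
    rcases hw : h.toWord with _ | ⟨x, xs⟩
    · refine ⟨(0, true), [], ?_, ?_⟩
      · have : k = 0 := by rw [← hl, hw]; rfl
        subst this
        simp [reducedAfter]
      · rw [← hw, FreeGroup.mk_toWord]
    · refine ⟨x, x :: xs, ?_, ?_⟩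
      · rw [← hl, ← hw]
        apply mem_reducedAfter
        rw [hw] at hr ⊢
        rw [FreeGroup.isReduced_cons_cons]
        exact ⟨fun _ => rfl, hr⟩
      · rw [← hw, FreeGroup.mk_toWord]
  calc _ ≤ _ := Finset.sum_le_sum_of_subset_of_nonneg hsub fun _ _ _ => (radialWeight_pos _).le
    _ ≤ ∑ l, ∑ L ∈ reducedAfter k l, radialWeight (g * FreeGroup.mk L) := by
        refine (sum_biUnion_le _ _ _ fun L => (radialWeight_pos _).le).trans ?_
        exact Finset.sum_le_sum fun x _ => sum_image_le _ _ _ fun L => (radialWeight_pos _).le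
    _ ≤ ∑ _l : Letter, (k + 1) * √3 ^ k * radialWeight g :=
        Finset.sum_le_sum fun l _ => sum_reducedAfter_le k l g
    _ = _ := by simp; ring

/-- The quadratic form of convolution with the indicator of a sphere. -/
lemma sum_sphere_mul_le (k : ℕ) (H : Finset F2) (hH : ∀ h ∈ H, h.norm = k) (S : Finset F2)
    (φ : F2 → ℝ) (hS : ∀ g ∉ S, φ g = 0) :
    ∑ h ∈ H, ∑ g ∈ S, φ g * φ (g * h) ≤ 4 * ((k + 1) * √3 ^ k) * ∑ g ∈ S, φ g ^ 2 := by
  classical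
  set K : ℝ := 4 * ((k + 1) * √3 ^ k)
  -- Schur test: weighted AM-GM, with the ratio of radial weights at the two points.
  have amgm : ∀ h g, φ g * φ (g * h) ≤
      1 / 2 * (φ g ^ 2 * (radialWeight (g * h) / radialWeight g)) +
      1 / 2 * (φ (g * h) ^ 2 * (radialWeight (g * h * h⁻¹) / radialWeight (g * h))) := by
    intro h g
    rw [mul_inv_cancel_right]
    have ha := radialWeight_pos g
    have hb := radialWeight_pos (g * h)
    set a := radialWeight g
    set b := radialWeight (g * h)
    have : 0 ≤ (b * φ g - a * φ (g * h)) ^ 2 / (2 * (a * b)) := by positivity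
    have e : (b * φ g - a * φ (g * h)) ^ 2 / (2 * (a * b)) =
      1 / 2 * (φ g ^ 2 * (b / a)) + 1 / 2 * (φ (g * h) ^ 2 * (a / b)) - φ g * φ (g * h) := by
      field_simp; ring
    linarith
  -- Stated for any subset of the sphere, since it is applied both to `H` and to the set of inverses
  -- of `H`.
  have first : ∀ H' : Finset F2, (∀ h ∈ H', h.norm = k) →
      ∑ g ∈ S, ∑ h ∈ H', φ g ^ 2 * (radialWeight (g * h) / radialWeight g) ≤
        K * ∑ g ∈ S, φ g ^ 2 := by
    intro H' hH'
    rw [Finset.mul_sum]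
    refine Finset.sum_le_sum fun g _ => ?_
    rw [← Finset.mul_sum, ← Finset.sum_div, mul_comm]
    refine mul_le_mul_of_nonneg_right ?_ (sq_nonneg _)
    rw [div_le_iff₀ (radialWeight_pos g)]
    exact sum_sphere_le k H' hH' g
  -- Substitute `g * h` for `g`; points that leave `S` contribute nothing because `φ` vanishes
  -- there.
  have second : ∀ h, ∑ g ∈ S, φ (g * h) ^ 2 * (radialWeight (g * h * h⁻¹) / radialWeight (g * h)) ≤
      ∑ g ∈ S, φ g ^ 2 * (radialWeight (g * h⁻¹) / radialWeight g) := by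
    intro h
    have hnn : ∀ g, 0 ≤ φ g ^ 2 * (radialWeight (g * h⁻¹) / radialWeight g) := fun g => by
      have := radialWeight_pos g
      have := radialWeight_pos (g * h⁻¹)
      positivity
    rw [← Finset.sum_image (s := S) (g := fun g => g * h)
      (f := fun g => φ g ^ 2 * (radialWeight (g * h⁻¹) / radialWeight g))
      (fun a _ b _ hab => mul_right_cancel hab)]
    rw [← Finset.sum_filter_add_sum_filter_not (S.image fun g => g * h) (· ∈ S)]
    rw [Finset.sum_eq_zero (s := (S.image fun g => g * h).filter (¬ · ∈ S)), add_zero]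
    · refine Finset.sum_le_sum_of_subset_of_nonneg ?_ fun g _ _ => hnn g
      intro g hg
      exact (Finset.mem_filter.mp hg).2
    · intro g hg
      rw [hS g (Finset.mem_filter.mp hg).2]; simp
  calc _ ≤ ∑ h ∈ H, ∑ g ∈ S, (1 / 2 * (φ g ^ 2 * (radialWeight (g * h) / radialWeight g)) +
      1 / 2 * (φ (g * h) ^ 2 * (radialWeight (g * h * h⁻¹) / radialWeight (g * h)))) :=
        Finset.sum_le_sum fun h _ => Finset.sum_le_sum fun g _ => amgm h g
    _ = 1 / 2 * (∑ g ∈ S, ∑ h ∈ H, φ g ^ 2 * (radialWeight (g * h) / radialWeight g)) + 1 / 2 *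
        ∑ h ∈ H, ∑ g ∈ S,
          φ (g * h) ^ 2 * (radialWeight (g * h * h⁻¹) / radialWeight (g * h)) := by
        simp only [Finset.sum_add_distrib]
        rw [Finset.sum_comm]
        simp only [Finset.mul_sum]
    _ ≤ 1 / 2 * (K * ∑ g ∈ S, φ g ^ 2) + 1 / 2 * (K * ∑ g ∈ S, φ g ^ 2) := by
        refine add_le_add (mul_le_mul_of_nonneg_left (first H hH) (by norm_num))
          (mul_le_mul_of_nonneg_left ?_ (by norm_num))
        refine (Finset.sum_le_sum fun h _ => second h).trans ?_
        have := first (H.image (·⁻¹)) (by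
          intro h hh
          obtain ⟨h', hh', rfl⟩ := Finset.mem_image.mp hh
          rw [FreeGroup.norm_inv_eq]; exact hH h' hh')
        refine le_trans (le_of_eq ?_) this
        rw [Finset.sum_comm]
        refine Finset.sum_congr rfl fun g _ => ?_
        rw [Finset.sum_image fun a _ b _ hab => inv_injective hab]
    _ = _ := by ring

/-! ### Matrix coefficients and densities -/

lemma matrixCoeff_eq (h : F2) : matrixCoeff h = if h = 1 then 1 else 0 := by
  rw [matrixCoeff, deltaOne, lp.inner_single_right]
  simp only [leftRegular, mul_one, lp.single_apply]
  by_cases hh : h = 1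
  · subst hh; simp
  · simp [hh]

lemma integrate_eq (φ : F2 → ℝ) : integrate φ = φ 1 := by
  rw [integrate, tsum_eq_single 1]
  · simp [matrixCoeff_eq]
  · intro h hh; simp [matrixCoeff_eq, hh]

/-- The number of words of length `n` with end letters `A, a` and product `g`. -/
def endCount (n : ℕ) (A a : Letter) (g : F2) : ℝ :=
  (((words n A a).filter fun w => wordProd w = g).card : ℝ)

lemma endCount_nonneg (n : ℕ) (A a : Letter) (g : F2) : 0 ≤ endCount n A a g := Nat.cast_nonneg _

lemma endCount_le_wordCount (n : ℕ) (A a : Letter) (g : F2) : endCount n A a g ≤ wordCount n g := by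
  refine Nat.cast_le.mpr (Finset.card_le_card ?_)
  intro w hw
  simp only [Finset.mem_filter, Finset.mem_univ, true_and] at hw ⊢
  exact hw.2

lemma density_eq (A a : Letter) (c : ℕ → ℝ) (N : ℕ) (t : ℝ) (g : F2) :
    density A a c N t g =
      ∑ n ∈ Finset.Icc 1 N, (t ^ n)⁻¹ * c n * ((1 / 4) ^ n * endCount n A a g) := by
  refine Finset.sum_congr rfl fun n _ => ?_
  simp only [wordWeight_eq, Finset.sum_const, nsmul_eq_mul, endCount]
  ring

/-- The word `A A⁻¹ w a⁻¹ a`, which has the same product as `w`. -/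
def capWord {n : ℕ} (A a : Letter) (w : Fin n → Letter) : Fin (n + 4) → Letter :=
  Fin.append (m := n + 2) (n := 2)
    (Fin.cons A (Fin.cons (Letter.inv A) w : Fin (n + 1) → Letter)) ![Letter.inv a, a]

lemma wordProd_capWord {n : ℕ} (A a : Letter) (w : Fin n → Letter) :
    wordProd (capWord A a w) = wordProd w := by
  have h2 : wordProd ![Letter.inv a, a] = 1 := by
    simp [wordProd, skew_inv]
  rw [capWord, wordProd_append, wordProd_cons, wordProd_cons, h2, skew_inv]
  simp

lemma capWord_mem {n : ℕ} (A a : Letter) (w : Fin n → Letter) : capWord A a w ∈ words (n + 4) A a := by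
  simp only [words, Finset.mem_filter, Finset.mem_univ, true_and, capWord]
  rw [List.ofFn_fin_append]
  refine ⟨by simp [List.ofFn_succ], ?_⟩
  rw [List.getLast?_append]
  simp [List.ofFn_succ]

lemma capWord_injective {n : ℕ} (A a : Letter) :
    Function.Injective (capWord A a : (Fin n → Letter) → (Fin (n + 4) → Letter)) := by
  intro w w' h
  have h1 := funext fun i => congrFun h (Fin.castAdd 2 i)
  simp only [capWord, Fin.append_left] at h1
  exact Fin.cons_right_injective (α := fun _ => Letter) _
    (Fin.cons_right_injective (α := fun _ => Letter) _ h1)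

/-- Capping costs four letters and keeps the product, so prescribing the end letters affects only
constants and a shift of length. -/
lemma wordCount_le_endCount (n : ℕ) (A a : Letter) (g : F2) :
    wordCount n g ≤ endCount (n + 4) A a g := by
  refine Nat.cast_le.mpr (Finset.card_le_card_of_injOn (capWord A a) ?_
    (capWord_injective A a).injOn)
  intro w hw
  simp only [Finset.coe_filter, Finset.mem_univ, true_and, Set.mem_ofPred_eq] at hw ⊢
  exact ⟨capWord_mem A a w, by rw [wordProd_capWord, hw]⟩

/-! ### The convergence parameter -/

/-- Words ending in the ball of radius `R` can be completed to closed words. -/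
lemma sum_ball_le_wordCount (n R : ℕ) :
    (∑ w : Fin n → Letter, if (wordProd w).norm ≤ R then (1 : ℝ) else 0) ≤
      ∑ j ∈ Finset.range (R + 1), wordCount (n + j) 1 := by
  have hj : ∀ j, (∑ w : Fin n → Letter, if (wordProd w).norm = j then (1 : ℝ) else 0) ≤
      wordCount (n + j) 1 := by
    intro j
    rw [wordCount_eq_sum, sum_append]
    refine Finset.sum_le_sum fun w _ => ?_
    have hnn : ∀ v : Fin j → Letter, 0 ≤ if wordProd (Fin.append w v) = 1 then (1 : ℝ) else 0 :=
      fun v => by split_ifs <;> norm_num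
    split_ifs with h
    · obtain ⟨v, hv⟩ : ∃ v : Fin j → Letter, wordProd v = (wordProd w)⁻¹ := by
        have := exists_wordProd (wordProd w)⁻¹
        rwa [FreeGroup.norm_inv_eq, h] at this
      refine le_trans ?_ (Finset.single_le_sum (fun v _ => hnn v) (Finset.mem_univ v))
      rw [wordProd_append, hv]; simp
    · exact Finset.sum_nonneg fun v _ => hnn v
  refine le_trans (le_of_eq ?_) (Finset.sum_le_sum fun j _ => hj j)
  rw [Finset.sum_comm]
  refine Finset.sum_congr rfl fun w _ => ?_
  rw [Finset.sum_ite_eq]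
  simp

/-- The radial function `3^{-k/2} sin(θ (k + 1))`, cut off at the radius `R`. -/
def sineProfile (R : ℕ) (k : ℕ) : ℝ :=
  if k ≤ R then (√3)⁻¹ ^ k * Real.sin (Real.pi / (R + 2) * (k + 1)) else 0

lemma sineProfile_nonneg (R k : ℕ) : 0 ≤ sineProfile R k := by
  unfold sineProfile
  split_ifs with h
  · refine mul_nonneg (by positivity) (Real.sin_nonneg_of_nonneg_of_le_pi (by positivity) ?_)
    rw [div_mul_eq_mul_div, div_le_iff₀ (by positivity)]
    have : (k : ℝ) ≤ R := by exact_mod_cast h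
    exact mul_le_mul_of_nonneg_left (by linarith) Real.pi_pos.le
  · rfl

lemma sineProfile_le (R k : ℕ) : sineProfile R k ≤ if k ≤ R then 1 else 0 := by
  unfold sineProfile
  split_ifs with h
  · have h3 : (√3)⁻¹ ≤ 1 := inv_le_one_of_one_le₀ (Real.one_le_sqrt.mpr (by norm_num))
    have := pow_le_one₀ (n := k) (by positivity) h3
    have h5 : (0 : ℝ) ≤ (√3)⁻¹ ^ k := by positivity
    nlinarith [Real.sin_le_one (Real.pi / (R + 2) * (k + 1))]
  · rfl

/-- The sine vanishes at `k = R + 1`, so the formula survives one step beyond the cutoff, as the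
recurrence at radius `R` requires. -/
lemma sineProfile_eq {R k : ℕ} (h : k ≤ R + 1) :
    sineProfile R k = (√3)⁻¹ ^ k * Real.sin (Real.pi / (R + 2) * (k + 1)) := by
  unfold sineProfile
  split_ifs with h'
  · rfl
  · have : k = R + 1 := by omega
    subst this
    have : Real.pi / (R + 2) * ((R + 1 : ℕ) + 1) = Real.pi := by
      push_cast
      field_simp; ring
    rw [this]; simp

/-- The factor `3^{-k/2}` balances one inward neighbour against three outward ones, and the addition
formula for the sine gives an exact eigenvalue inside the ball. The identity has four outward
neighbours instead of three, an error in the right direction. -/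
lemma sineProfile_subsolution (R : ℕ) (g : F2) :
    2 * √3 * Real.cos (Real.pi / (R + 2)) * sineProfile R g.norm ≤
      ∑ l, sineProfile R (skew l * g).norm := by
  by_cases hR : g.norm ≤ R
  swap
  · rw [sineProfile, if_neg hR, mul_zero]
    exact Finset.sum_nonneg fun l _ => sineProfile_nonneg _ _
  set θ := Real.pi / (R + 2)
  have h3 : (0 : ℝ) < √3 := by positivity
  have e : ∀ k : ℝ, 2 * Real.cos θ * Real.sin (θ * (k + 1)) =
      Real.sin (θ * k) + Real.sin (θ * (k + 2)) := by
    intro k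
    have e1 : θ * k = θ * (k + 1) - θ := by ring
    have e2 : θ * (k + 2) = θ * (k + 1) + θ := by ring
    rw [e1, e2, Real.sin_sub, Real.sin_add]; ring
  by_cases hg : g = 1
  · subst hg
    rw [sum_norm_skew_mul_one, FreeGroup.norm_one]
    have h4 : 3 * sineProfile R 1 ≤ 4 * sineProfile R 1 := by
      linarith [sineProfile_nonneg R 1]
    refine le_trans (le_of_eq ?_) h4
    rw [sineProfile_eq (by omega), sineProfile_eq (by omega)]
    have := e 0
    simp only [mul_zero, Real.sin_zero, zero_add] at this
    push_cast
    simp only [pow_zero, one_mul, zero_add, pow_one]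
    rw [show (1 : ℝ) + 1 = 2 by norm_num]
    calc _ = √3 * (2 * Real.cos θ * Real.sin (θ * 1)) := by ring
      _ = (3 * (√3)⁻¹) * Real.sin (θ * 2) := by rw [this, sqrt_three_mul]
      _ = _ := by ring
  · rw [sum_norm_skew_mul hg]
    have hk : g.norm ≠ 0 := fun h => hg (FreeGroup.norm_eq_zero.mp h)
    obtain ⟨k, hk⟩ := Nat.exists_eq_succ_of_ne_zero hk
    rw [hk] at hR ⊢
    simp only [Nat.succ_eq_add_one, Nat.add_sub_cancel] at hR ⊢
    rw [sineProfile_eq (by omega), sineProfile_eq (by omega), sineProfile_eq (by omega)]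
    apply le_of_eq
    have := e (k + 1)
    push_cast
    have e3 : (√3)⁻¹ ^ k = √3 * (√3)⁻¹ ^ (k + 1) := by rw [pow_succ]; field_simp
    calc _ = √3 * (√3)⁻¹ ^ (k + 1) * (2 * Real.cos θ * Real.sin (θ * (k + 1 + 1))) := by ring
      _ = √3 * (√3)⁻¹ ^ (k + 1) * Real.sin (θ * (k + 1)) +
          (3 * (√3)⁻¹) * (√3)⁻¹ ^ (k + 1) * Real.sin (θ * (k + 1 + 2)) := by
            rw [this, sqrt_three_mul]; ring
      _ = _ := by
        rw [e3, show (k : ℝ) + 1 + 1 + 1 = k + 1 + 2 by ring, pow_succ _ (k + 1)]; ring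

lemma le_of_pow_le_const_mul_pow {x y C : ℝ} (hy : 0 < y) (h : ∀ n : ℕ, x ^ n ≤ C * y ^ n) :
    x ≤ y := by
  by_contra hxy
  push Not at hxy
  have h1 : 1 < x / y := (one_lt_div hy).mpr hxy
  obtain ⟨n, hn⟩ := pow_unbounded_of_one_lt C h1
  have := h n
  rw [div_pow, lt_div_iff₀ (by positivity)] at hn
  linarith

/-- Exponential growth bounds on the number of closed words are at least `2√3`. -/
lemma two_sqrt_three_le {s C : ℝ} (hs : 0 < s) (hC : ∀ n, wordCount n 1 ≤ C * s ^ n) :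
    2 * √3 ≤ s := by
  have hC0 : 0 ≤ C := by simpa using (wordCount_nonneg 0 1).trans (hC 0)
  have key : ∀ R : ℕ, 2 * √3 * Real.cos (Real.pi / (R + 2)) ≤ s := by
    intro R
    have hθ : Real.pi / (R + 2) ≤ Real.pi / 2 := by
      apply div_le_div_of_nonneg_left Real.pi_pos.le (by norm_num)
      linarith [(Nat.cast_nonneg R : (0 : ℝ) ≤ R)]
    have hθ0 : 0 < Real.pi / (R + 2) := by positivity
    have hcos : 0 ≤ Real.cos (Real.pi / (R + 2)) :=
      Real.cos_nonneg_of_neg_pi_div_two_le_of_le (by linarith [Real.pi_pos]) hθ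
    have hsin : 0 < Real.sin (Real.pi / (R + 2)) :=
      Real.sin_pos_of_pos_of_lt_pi hθ0 (by linarith [Real.pi_pos])
    set D := ∑ j ∈ Finset.range (R + 1), C * s ^ j
    -- For fixed `R` the prefactor is independent of `n`, so only the exponential rates matter.
    refine le_of_pow_le_const_mul_pow hs (C := D / Real.sin (Real.pi / (R + 2))) fun n => ?_
    have h1 := le_sum_wordProd (u := fun g => sineProfile R g.norm) (by positivity)
      (sineProfile_subsolution R) n 1
    simp only [mul_one, FreeGroup.norm_one] at h1
    rw [sineProfile_eq (by omega)] at h1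
    simp only [pow_zero, one_mul, Nat.cast_zero, zero_add, mul_one] at h1
    have h2 := h1.trans ((Finset.sum_le_sum fun w _ => sineProfile_le R _).trans
      ((sum_ball_le_wordCount n R).trans (Finset.sum_le_sum fun j _ => hC (n + j))))
    have h3 : ∑ j ∈ Finset.range (R + 1), C * s ^ (n + j) = D * s ^ n := by
      rw [Finset.sum_mul]
      refine Finset.sum_congr rfl fun j _ => ?_
      rw [pow_add]; ring
    rw [h3] at h2
    rw [div_mul_eq_mul_div, le_div_iff₀ hsin]
    exact h2
  have hlim : Tendsto (fun R : ℕ => 2 * √3 * Real.cos (Real.pi / (R + 2))) atTop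
      (𝓝 (2 * √3 * Real.cos 0)) := by
    refine Tendsto.const_mul _ ((Real.continuous_cos.tendsto 0).comp ?_)
    refine Tendsto.div_atTop tendsto_const_nhds ?_
    exact tendsto_atTop_add_const_right _ _ tendsto_natCast_atTop_atTop
  rw [Real.cos_zero, mul_one] at hlim
  exact le_of_tendsto' hlim key

/-- The convergence parameter is at least the spectral radius `√3/2` of the walk. -/
lemma sqrt_three_div_two_le_criticalParam (A a : Letter) : √3 / 2 ≤ criticalParam A a := by
  refine le_csInf ?_ ?_
  -- The infimum is over a nonempty set: at `t = 2` the trivial count `4^n` gives a geometric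
  -- series.
  · refine ⟨2, by norm_num, 2, ?_⟩
    rintro _ ⟨N, rfl⟩
    simp only [integrate_eq, density_eq]
    have : ∀ n, ((2 : ℝ) ^ n)⁻¹ * 1 * ((1 / 4) ^ n * endCount n A a 1) ≤ (1 / 2) ^ n := by
      intro n
      have h := (endCount_le_wordCount n A a 1).trans (wordCount_le n 1)
      rw [FreeGroup.norm_one, pow_zero, mul_one] at h
      have h2 : (1 / 4 : ℝ) ^ n * endCount n A a 1 ≤ 1 := by
        calc _ ≤ (1 / 4 : ℝ) ^ n * 4 ^ n := by gcongr
          _ = 1 := by rw [← mul_pow]; norm_num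
      calc _ ≤ ((2 : ℝ) ^ n)⁻¹ * 1 * 1 := by gcongr
        _ = _ := by simp
    refine (Finset.sum_le_sum fun n _ => this n).trans ?_
    exact sum_le_hasSum _ (fun _ _ => by positivity) hasSum_geometric_two
  · rintro t ⟨ht, C, hC⟩
    -- The factor `(4 * t) ^ 4` pays for the four letters of the cap.
    have h := two_sqrt_three_le (s := 4 * t) (C := C * (4 * t) ^ 4) (by positivity) ?_
    · linarith
    intro n
    have h1 := hC ⟨n + 4, rfl⟩
    simp only [integrate_eq, density_eq] at h1
    have h2 := (Finset.single_le_sum (f := fun n => (t ^ n)⁻¹ * 1 * ((1 / 4) ^ n * endCount n A a 1))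
      (fun i _ => by have := endCount_nonneg i A a 1; positivity)
      (Finset.mem_Icc.mpr ⟨by omega, le_refl (n + 4)⟩)).trans h1
    have h3 := wordCount_le_endCount n A a 1
    have h4 : (t ^ (n + 4))⁻¹ * 1 * ((1 / 4) ^ (n + 4) * endCount (n + 4) A a 1) =
        endCount (n + 4) A a 1 / ((4 * t) ^ 4 * (4 * t) ^ n) := by
      rw [← pow_add, add_comm 4 n, mul_pow, one_div, inv_pow]
      field_simp
    simp only [h4] at h2
    rw [div_le_iff₀ (by positivity)] at h2
    linarith

/-! ### Densities over all words -/

/-- The weight `t^{-n} c_n 4^{-n}` of a word of length `n`. -/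
def levelWeight (c : ℕ → ℝ) (t : ℝ) (n : ℕ) : ℝ := (t ^ n)⁻¹ * c n * (1 / 4) ^ n

lemma levelWeight_pos {c : ℕ → ℝ} (hc : ∀ n, 0 < c n) {t : ℝ} (ht : 0 < t) (n : ℕ) :
    0 < levelWeight c t n := by
  have := hc n
  unfold levelWeight; positivity

lemma levelWeight_add (c : ℕ → ℝ) {t : ℝ} (ht : 0 < t) (m n : ℕ) :
    (4 * t) ^ n * levelWeight c t (m + n) = (t ^ m)⁻¹ * c (m + n) * (1 / 4) ^ m := by
  unfold levelWeight
  rw [pow_add, pow_add, mul_pow, one_div, inv_pow, inv_pow]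
  field_simp

lemma levelWeight_le {c : ℕ → ℝ} {t : ℝ} (ht : 0 < t) {C : ℝ} {m n : ℕ}
    (h : c m ≤ C * c (m + n)) :
    levelWeight c t m ≤ C * (4 * t) ^ n * levelWeight c t (m + n) := by
  rw [mul_assoc, levelWeight_add c ht, levelWeight]
  calc _ ≤ (t ^ m)⁻¹ * (C * c (m + n)) * (1 / 4) ^ m := by gcongr
    _ = _ := by ring

lemma density_eq_levelWeight (A a : Letter) (c : ℕ → ℝ) (N : ℕ) (t : ℝ) (g : F2) :
    density A a c N t g = ∑ n ∈ Finset.Icc 1 N, levelWeight c t n * endCount n A a g := by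
  rw [density_eq]
  exact Finset.sum_congr rfl fun n _ => by rw [levelWeight]; ring

lemma density_nonneg (A a : Letter) {c : ℕ → ℝ} (hc : ∀ n, 0 < c n) (N : ℕ) {t : ℝ} (ht : 0 < t)
    (g : F2) : 0 ≤ density A a c N t g := by
  rw [density_eq_levelWeight]
  exact Finset.sum_nonneg fun n _ => mul_nonneg (levelWeight_pos hc ht n).le (endCount_nonneg ..)

/-- The density of the words of lengths `1, …, N` without constraint on the end letters. -/
def freeDensity (c : ℕ → ℝ) (N : ℕ) (t : ℝ) (g : F2) : ℝ :=
  ∑ n ∈ Finset.Icc 1 N, levelWeight c t n * wordCount n g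

lemma freeDensity_nonneg {c : ℕ → ℝ} (hc : ∀ n, 0 < c n) (N : ℕ) {t : ℝ} (ht : 0 < t) (g : F2) :
    0 ≤ freeDensity c N t g :=
  Finset.sum_nonneg fun n _ => mul_nonneg (levelWeight_pos hc ht n).le (wordCount_nonneg ..)

/-- Inverting words preserves their length. Fixed end letters need not respect this symmetry, which
is why the constraint is dropped. -/
lemma freeDensity_inv (c : ℕ → ℝ) (N : ℕ) (t : ℝ) (g : F2) :
    freeDensity c N t g⁻¹ = freeDensity c N t g := by
  simp [freeDensity, wordCount_inv]

lemma sum_Icc_add_le {f : ℕ → ℝ} (hf : ∀ n, 0 ≤ f n) (N k : ℕ) :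
    ∑ n ∈ Finset.Icc 1 N, f (n + k) ≤ ∑ n ∈ Finset.Icc 1 (N + k), f n := by
  rw [← Finset.sum_image (f := f) (g := fun n => n + k) (fun a _ b _ h => Nat.add_right_cancel h)]
  refine Finset.sum_le_sum_of_subset_of_nonneg ?_ fun n _ _ => hf n
  intro n hn
  simp only [Finset.mem_image, Finset.mem_Icc] at hn ⊢
  omega

lemma freeDensity_le_density (A a : Letter) {c : ℕ → ℝ} (hc : ∀ n, 0 < c n) (hm : Monotone c)
    (N : ℕ) {t : ℝ} (ht : 0 < t) (g : F2) :
    freeDensity c N t g ≤ (4 * t) ^ 4 * density A a c (N + 4) t g := by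
  rw [density_eq_levelWeight]
  refine le_trans ?_ (mul_le_mul_of_nonneg_left (sum_Icc_add_le (fun n =>
    mul_nonneg (levelWeight_pos hc ht n).le (endCount_nonneg n A a g)) N 4) (by positivity))
  rw [Finset.mul_sum]
  refine Finset.sum_le_sum fun n _ => ?_
  have h1 : levelWeight c t n ≤ 1 * (4 * t) ^ 4 * levelWeight c t (n + 4) :=
    levelWeight_le ht (by rw [one_mul]; exact hm (by omega))
  rw [one_mul] at h1
  calc _ ≤ ((4 * t) ^ 4 * levelWeight c t (n + 4)) * endCount (n + 4) A a g :=
        mul_le_mul h1 (wordCount_le_endCount ..) (wordCount_nonneg ..)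
          ((levelWeight_pos hc ht n).le.trans h1)
    _ = _ := by ring

/-- The group elements represented by words of lengths `1, …, N`. -/
def walkRange (N : ℕ) : Finset F2 :=
  (Finset.Icc 1 N).biUnion fun n => Finset.univ.image fun w : Fin n → Letter => wordProd w

lemma wordProd_mem_walkRange {n N : ℕ} (hn : n ∈ Finset.Icc 1 N) (w : Fin n → Letter) :
    wordProd w ∈ walkRange N :=
  Finset.mem_biUnion.mpr ⟨n, hn, Finset.mem_image_of_mem _ (Finset.mem_univ w)⟩

lemma wordCount_eq_zero {n N : ℕ} (hn : n ∈ Finset.Icc 1 N) {g : F2} (hg : g ∉ walkRange N) :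
    wordCount n g = 0 := by
  rw [wordCount_eq_sum]
  refine Finset.sum_eq_zero fun w _ => if_neg ?_
  rintro rfl
  exact hg (wordProd_mem_walkRange hn w)

lemma freeDensity_eq_zero (c : ℕ → ℝ) {N : ℕ} (t : ℝ) {g : F2} (hg : g ∉ walkRange N) :
    freeDensity c N t g = 0 :=
  Finset.sum_eq_zero fun n hn => by rw [wordCount_eq_zero hn hg, mul_zero]

lemma density_eq_zero (A a : Letter) (c : ℕ → ℝ) {N : ℕ} (t : ℝ) {g : F2} (hg : g ∉ walkRange N) :
    density A a c N t g = 0 := by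
  rw [density_eq_levelWeight]
  refine Finset.sum_eq_zero fun n hn => ?_
  have h1 := endCount_le_wordCount n A a g
  rw [wordCount_eq_zero hn hg] at h1
  rw [le_antisymm h1 (endCount_nonneg ..), mul_zero]

lemma sum_wordProd_eq {n : ℕ} {S : Finset F2} (hS : ∀ w : Fin n → Letter, wordProd w ∈ S)
    (f : F2 → ℝ) : ∑ w : Fin n → Letter, f (wordProd w) = ∑ g ∈ S, wordCount n g * f g := by
  rw [← Finset.sum_fiberwise_of_maps_to' (t := S) (g := fun w : Fin n → Letter => wordProd w)
    (fun w _ => hS w)]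
  refine Finset.sum_congr rfl fun g _ => ?_
  rw [Finset.sum_const, nsmul_eq_mul, wordCount]

/-- The `ℓ²` norm of the free density is controlled by the normalising factor. -/
lemma sum_freeDensity_sq_le (A a : Letter) {c : ℕ → ℝ} (hc : ∀ n, 0 < c n) (hm : Monotone c)
    (N : ℕ) {t : ℝ} (ht : 0 < t)
    (hb : BddAbove (Set.range fun N : ℕ =>
      integrate (conv (density A a c N t) (density A a c N t)))) (S : Finset F2) :
    ∑ g ∈ S, freeDensity c N t g ^ 2 ≤ (4 * t) ^ 8 * normFactor A a c t := by
  have h1 := le_ciSup hb (N + 4)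
  change _ ≤ normFactor A a c t at h1
  refine le_trans ?_ (mul_le_mul_of_nonneg_left h1 (by positivity))
  rw [integrate_eq, conv]
  have hs : Summable fun h => density A a c (N + 4) t h * density A a c (N + 4) t (h⁻¹ * 1) := by
    refine summable_of_ne_finset_zero (s := walkRange (N + 4)) fun g hg => ?_
    rw [density_eq_zero A a c t hg, zero_mul]
  refine le_trans ?_ (mul_le_mul_of_nonneg_left (hs.sum_le_tsum S fun g _ =>
    mul_nonneg (density_nonneg A a hc _ ht _) (density_nonneg A a hc _ ht _)) (by positivity))
  rw [Finset.mul_sum]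
  refine Finset.sum_le_sum fun g _ => ?_
  rw [mul_one]
  -- By symmetry the square is a term of the convolution at the identity; capping both factors gives
  -- the eighth power of `4 * t`.
  calc freeDensity c N t g ^ 2 = freeDensity c N t g * freeDensity c N t g⁻¹ := by
        rw [freeDensity_inv, sq]
    _ ≤ ((4 * t) ^ 4 * density A a c (N + 4) t g) * ((4 * t) ^ 4 * density A a c (N + 4) t g⁻¹) :=
        mul_le_mul (freeDensity_le_density A a hc hm N ht g)
          (freeDensity_le_density A a hc hm N ht g⁻¹) (freeDensity_nonneg hc N ht _)
          (mul_nonneg (by positivity) (density_nonneg A a hc _ ht _))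
    _ = _ := by ring

/-- Words of length `n` whose product has length at least `q` contribute little to the
autocorrelation of a function in `ℓ²`. -/
lemma sum_long_words_le (n q : ℕ) (S : Finset F2) (φ : F2 → ℝ) (hφ : ∀ g, 0 ≤ φ g)
    (hS : ∀ g ∉ S, φ g = 0) :
    ∑ w : Fin n → Letter, (if q ≤ (wordProd w).norm then ∑ g ∈ S, φ g * φ (g * wordProd w) else 0) ≤
      4 * (n + 1) ^ 2 * 4 ^ n * (√3)⁻¹ ^ q * ∑ g ∈ S, φ g ^ 2 := by
  classical
  set G : F2 → ℝ := fun h => ∑ g ∈ S, φ g * φ (g * h) with hG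
  have hG0 : ∀ h, 0 ≤ G h := fun h => Finset.sum_nonneg fun g _ => mul_nonneg (hφ _) (hφ _)
  set Q := ∑ g ∈ S, φ g ^ 2
  have hQ : 0 ≤ Q := Finset.sum_nonneg fun g _ => sq_nonneg _
  set T : Finset F2 := Finset.univ.image fun w : Fin n → Letter => wordProd w
  rw [sum_wordProd_eq (S := T) (fun w => Finset.mem_image_of_mem _ (Finset.mem_univ w))
    (fun h => if q ≤ h.norm then G h else 0)]
  have hT : ∀ h ∈ T, h.norm ∈ Finset.range (n + 1) := by
    intro h hh
    obtain ⟨w, _, rfl⟩ := Finset.mem_image.mp hh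
    exact Finset.mem_range.mpr (Nat.lt_succ_of_le (norm_wordProd_le w))
  rw [← Finset.sum_fiberwise_of_maps_to hT]
  have hr : (√3)⁻¹ ≤ 1 := inv_le_one_of_one_le₀ (Real.one_le_sqrt.mpr (by norm_num))
  -- On the sphere of radius `k` the count `4^n 3^{-k}` meets the norm `3^{k/2}`, leaving
  -- `3^{-k/2}`. Summing over `n + 1` radii produces the second factor `n + 1`.
  have hfib : ∀ k ∈ Finset.range (n + 1),
      ∑ h ∈ T.filter (fun h => h.norm = k), wordCount n h * (if q ≤ h.norm then G h else 0) ≤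
        4 * (n + 1) * 4 ^ n * (√3)⁻¹ ^ q * Q := by
    intro k hk
    by_cases hqk : q ≤ k
    · calc _ ≤ ∑ h ∈ T.filter (fun h => h.norm = k), (4 ^ n * (1 / 3) ^ k) * G h := by
            refine Finset.sum_le_sum fun h hh => ?_
            have hhk := (Finset.mem_filter.mp hh).2
            have := wordCount_le n h
            rw [hhk] at this
            rw [hhk, if_pos hqk]
            exact mul_le_mul_of_nonneg_right this (hG0 h)
        _ ≤ (4 ^ n * (1 / 3) ^ k) * (4 * ((k + 1) * √3 ^ k) * Q) := by
            rw [← Finset.mul_sum]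
            refine mul_le_mul_of_nonneg_left ?_ (by positivity)
            exact sum_sphere_mul_le k _ (fun h hh => (Finset.mem_filter.mp hh).2) S φ hS
        _ = 4 * (k + 1) * 4 ^ n * (√3)⁻¹ ^ k * Q := by
            have : (1 / 3 : ℝ) ^ k * √3 ^ k = (√3)⁻¹ ^ k := by
              rw [← mul_pow]
              congr 1
              linarith [sqrt_three_mul]
            rw [← this]; ring
        _ ≤ _ := by
            have hkn : (k : ℝ) ≤ n := by
              exact_mod_cast Nat.lt_succ_iff.mp (Finset.mem_range.mp hk)
            have := pow_le_pow_of_le_one (by positivity) hr hqk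
            gcongr
    · rw [Finset.sum_eq_zero]
      · positivity
      · intro h hh
        rw [(Finset.mem_filter.mp hh).2, if_neg hqk, mul_zero]
  refine (Finset.sum_le_sum hfib).trans (le_of_eq ?_)
  rw [Finset.sum_const, Finset.card_range, nsmul_eq_mul]
  push_cast; ring

/-! ### The approximating measures on cylinders -/

lemma backwardProd_insertWords {m n ℓ : ℕ} (z : Shift) (u : Fin m → Letter) (w : Fin ℓ → Letter)
    (v : Fin n → Letter) : backwardProd (insertWords z (Fin.append u w) v) ℓ = wordProd w := by
  unfold backwardProd
  congr 1
  ext1 i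
  have hi := i.2
  unfold insertWords
  rw [if_neg (by push_cast; omega), dif_pos (by constructor <;> push_cast <;> omega)]
  have : (⟨((i : ℤ) - ℓ + ((m + ℓ : ℕ) : ℤ)).toNat, by push_cast; omega⟩ : Fin (m + ℓ)) =
      Fin.natAdd m i := by
    ext
    simp only [Fin.val_natAdd]
    push_cast; omega
  rw [this, Fin.append_right]

/-- Words with first letter `A`. -/
def headWords (n : ℕ) (A : Letter) : Finset (Fin n → Letter) :=
  Finset.univ.filter fun w => (List.ofFn w).head? = some A

/-- Words with last letter `a`. -/
def lastWords (n : ℕ) (a : Letter) : Finset (Fin n → Letter) :=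
  Finset.univ.filter fun w => (List.ofFn w).getLast? = some a

lemma sum_words_last (n : ℕ) (A : Letter) {f : (Fin n → Letter) → ℝ} (hf : ∀ w, 0 ≤ f w) :
    ∑ B, ∑ w ∈ words n A B, f w ≤ ∑ w ∈ headWords n A, f w := by
  simp only [words, headWords, Finset.sum_filter]
  rw [Finset.sum_comm]
  refine Finset.sum_le_sum fun w _ => ?_
  rcases hl : (List.ofFn w).getLast? with _ | y
  · simp only [reduceCtorEq, and_false, if_false, Finset.sum_const_zero]
    split_ifs
    exacts [hf w, le_rfl]
  · split_ifs with h
    · simp [h]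
    · simp [h]

lemma sum_words_head (n : ℕ) (a : Letter) {f : (Fin n → Letter) → ℝ} (hf : ∀ w, 0 ≤ f w) :
    ∑ b, ∑ w ∈ words n b a, f w ≤ ∑ w ∈ lastWords n a, f w := by
  simp only [words, lastWords, Finset.sum_filter]
  rw [Finset.sum_comm]
  refine Finset.sum_le_sum fun w _ => ?_
  rcases hl : (List.ofFn w).head? with _ | y
  · simp only [reduceCtorEq, false_and, if_false, Finset.sum_const_zero]
    split_ifs
    exacts [hf w, le_rfl]
  · split_ifs with h
    · simp [h]
    · simp [h]

/-- The indicator of `s(u) s(v) = e` and `X u . v x ∈ E`. -/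
def closedIndicator (z : Shift) (E : Set Shift) {m n : ℕ} (u : Fin m → Letter)
    (v : Fin n → Letter) : ℝ :=
  matrixCoeff (wordProd u * wordProd v) * E.indicator 1 (insertWords z u v)

lemma closedIndicator_nonneg (z : Shift) (E : Set Shift) {m n : ℕ} (u : Fin m → Letter)
    (v : Fin n → Letter) : 0 ≤ closedIndicator z E u v := by
  unfold closedIndicator
  rw [matrixCoeff_eq]
  refine mul_nonneg (by split_ifs <;> norm_num) (Set.indicator_nonneg (fun _ _ => zero_le_one) _)

lemma closedIndicator_le (z : Shift) (E : Set Shift) {m n : ℕ} (u : Fin m → Letter)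
    (v : Fin n → Letter) :
    closedIndicator z E u v ≤ if wordProd u * wordProd v = 1 then 1 else 0 := by
  unfold closedIndicator
  rw [matrixCoeff_eq]
  split_ifs
  · rw [one_mul]
    exact Set.indicator_le_self' (fun _ _ => zero_le_one) _
  · simp

/-- The mass that words `u` of length `m` contribute to the set `E`, before normalisation. -/
def levelMass (A a : Letter) (c : ℕ → ℝ) (z : Shift) (N : ℕ) (t : ℝ) (E : Set Shift) (m : ℕ) : ℝ :=
  ∑ u ∈ headWords m A, ∑ n ∈ Finset.Icc 1 N, levelWeight c t n *
    ∑ v ∈ lastWords n a, closedIndicator z E u v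

lemma approxMeasure_apply (A a : Letter) (c : ℕ → ℝ) (z : Shift) (N : ℕ) (t : ℝ) {E : Set Shift}
    (hE : MeasurableSet E) :
    (approxMeasure A a c z N t E : ℝ) =
      ∑ B : Letter, ∑ b : Letter, ∑ n ∈ Finset.Icc 1 N, ∑ m ∈ Finset.Icc 1 N,
      ∑ v ∈ words n b a, ∑ u ∈ words m A B,
        (Real.toNNReal ((t ^ n)⁻¹ * c n * ((t ^ m)⁻¹ * c m) * wordWeight v * wordWeight u *
          matrixCoeff (wordProd u * wordProd v) / normFactor A a c t) : ℝ) *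
        E.indicator 1 (insertWords z u v) := by
  have happ : ∀ μ : FiniteMeasure Shift, (μ E : ℝ) = (μ : Measure Shift).real E := fun _ => rfl
  have hadd : ∀ (μ ν : FiniteMeasure Shift), (((μ + ν) E : NNReal) : ℝ) = μ E + ν E := by
    intro μ ν
    rw [FiniteMeasure.coeFn_add]; simp
  let ev : FiniteMeasure Shift →+ ℝ :=
    { toFun := fun μ => (μ E : ℝ), map_zero' := by simp, map_add' := hadd }
  have hd : ∀ (r : NNReal) (y : Shift), ev (r • diracMass y) = (r : ℝ) * E.indicator 1 y := by
    intro r y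
    change (((r • diracMass y) E : NNReal) : ℝ) = _
    rw [FiniteMeasure.coeFn_smul, Pi.smul_apply, smul_eq_mul, NNReal.coe_mul]
    congr 1
    rw [happ]
    change (Measure.dirac y).real E = _
    rw [Measure.real, Measure.dirac_apply' y hE]
    by_cases hy : y ∈ E <;> simp [hy]
  change ev (approxMeasure A a c z N t) = _
  simp only [approxMeasure, map_sum, hd]

lemma approxMeasure_le (A a : Letter) {c : ℕ → ℝ} (hc : ∀ n, 0 < c n) (z : Shift) (N : ℕ) {t : ℝ}
    (ht : 0 < t) (hF : 0 < normFactor A a c t) {E : Set Shift} (hE : MeasurableSet E) :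
    (approxMeasure A a c z N t E : ℝ) ≤
      (∑ m ∈ Finset.Icc 1 N, levelWeight c t m * levelMass A a c z N t E m) / normFactor A a c t := by
  rw [approxMeasure_apply A a c z N t hE, le_div_iff₀ hF]
  have hterm : ∀ {m n : ℕ} (u : Fin m → Letter) (v : Fin n → Letter),
      (Real.toNNReal ((t ^ n)⁻¹ * c n * ((t ^ m)⁻¹ * c m) * wordWeight v * wordWeight u *
          matrixCoeff (wordProd u * wordProd v) / normFactor A a c t) : ℝ) *
        E.indicator 1 (insertWords z u v) * normFactor A a c t =
      levelWeight c t n * levelWeight c t m * closedIndicator z E u v := by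
    intro m n u v
    have h1 := hc m
    have h2 := hc n
    have h3 : 0 ≤ matrixCoeff (wordProd u * wordProd v) := by
      rw [matrixCoeff_eq]; split_ifs <;> norm_num
    rw [wordWeight_eq, wordWeight_eq, Real.coe_toNNReal _ (by positivity), closedIndicator,
      levelWeight, levelWeight]
    field_simp
  simp only [Finset.sum_mul, hterm]
  have hK := fun n => (levelWeight_pos hc ht n).le
  calc _ = ∑ n ∈ Finset.Icc 1 N, ∑ m ∈ Finset.Icc 1 N, levelWeight c t n * levelWeight c t m *
        ∑ B, ∑ u ∈ words m A B, ∑ b, ∑ v ∈ words n b a, closedIndicator z E u v := by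
        simp only [Finset.mul_sum]
        calc _ = ∑ B : Letter, ∑ n ∈ Finset.Icc 1 N, ∑ m ∈ Finset.Icc 1 N, ∑ b : Letter,
              ∑ v ∈ words n b a, ∑ u ∈ words m A B,
              levelWeight c t n * levelWeight c t m * closedIndicator z E u v := by
              refine Finset.sum_congr rfl fun B _ => ?_
              rw [Finset.sum_comm]
              exact Finset.sum_congr rfl fun n _ => Finset.sum_comm
          _ = _ := by
              rw [Finset.sum_comm]
              refine Finset.sum_congr rfl fun n _ => ?_
              rw [Finset.sum_comm]
              refine Finset.sum_congr rfl fun m _ => Finset.sum_congr rfl fun B _ => ?_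
              symm
              rw [Finset.sum_comm]
              refine Finset.sum_congr rfl fun b _ => ?_
              rw [Finset.sum_comm]
    _ ≤ ∑ n ∈ Finset.Icc 1 N, ∑ m ∈ Finset.Icc 1 N, levelWeight c t n * levelWeight c t m *
        ∑ u ∈ headWords m A, ∑ v ∈ lastWords n a, closedIndicator z E u v := by
        refine Finset.sum_le_sum fun n _ => Finset.sum_le_sum fun m _ =>
          mul_le_mul_of_nonneg_left ?_ (mul_nonneg (hK n) (hK m))
        refine (sum_words_last m A fun u => Finset.sum_nonneg fun b _ => Finset.sum_nonneg
          fun v _ => closedIndicator_nonneg z E u v).trans ?_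
        exact Finset.sum_le_sum fun u _ => sum_words_head n a fun v =>
          closedIndicator_nonneg z E u v
    _ = _ := by
        rw [Finset.sum_comm]
        refine Finset.sum_congr rfl fun m _ => ?_
        rw [levelMass, Finset.mul_sum]
        simp only [Finset.mul_sum]
        rw [Finset.sum_comm]
        refine Finset.sum_congr rfl fun u _ => Finset.sum_congr rfl fun n _ =>
          Finset.sum_congr rfl fun v _ => ?_
        ring

lemma levelMass_nonneg (A a : Letter) {c : ℕ → ℝ} (hc : ∀ n, 0 < c n) (z : Shift) (N : ℕ) {t : ℝ}
    (ht : 0 < t) (E : Set Shift) (m : ℕ) : 0 ≤ levelMass A a c z N t E m :=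
  Finset.sum_nonneg fun u _ => Finset.sum_nonneg fun n _ => mul_nonneg (levelWeight_pos hc ht n).le
    (Finset.sum_nonneg fun v _ => closedIndicator_nonneg z E u v)

/-- A bound in terms of closed words, for words `u` of bounded length. -/
lemma levelWeight_mul_levelMass_le (A a : Letter) {c : ℕ → ℝ} (hc : ∀ n, 0 < c n)
    (hm : Monotone c) (z : Shift) (N : ℕ) {t : ℝ} (ht : 0 < t)
    (hb : BddAbove (Set.range fun N : ℕ => integrate (density A a c N t))) (E : Set Shift) (m : ℕ) :
    levelWeight c t m * levelMass A a c z N t E m ≤ c m * 4 ^ m * singleSeries A a c t := by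
  -- For fixed `u`, appending `v` injects into the closed words with both end letters prescribed,
  -- which the single series counts.
  have hfix : ∀ u ∈ headWords m A, ∑ n ∈ Finset.Icc 1 N, levelWeight c t n *
      ∑ v ∈ lastWords n a, closedIndicator z E u v ≤ (4 * t) ^ m * singleSeries A a c t := by
    intro u hu
    have h1 := le_ciSup hb (N + m)
    change _ ≤ singleSeries A a c t at h1
    refine le_trans ?_ (mul_le_mul_of_nonneg_left h1 (by positivity))
    rw [integrate_eq, density_eq_levelWeight]
    refine le_trans ?_ (mul_le_mul_of_nonneg_left (sum_Icc_add_le (fun n =>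
      mul_nonneg (levelWeight_pos hc ht n).le (endCount_nonneg n A a 1)) N m) (by positivity))
    rw [Finset.mul_sum]
    refine Finset.sum_le_sum fun n _ => ?_
    have hcount : ∑ v ∈ lastWords n a, closedIndicator z E u v ≤ endCount (m + n) A a 1 := by
      calc _ ≤ ∑ v ∈ lastWords n a, if wordProd u * wordProd v = 1 then (1 : ℝ) else 0 :=
            Finset.sum_le_sum fun v _ => closedIndicator_le z E u v
        _ = (((lastWords n a).filter fun v => wordProd u * wordProd v = 1).card : ℝ) := by simp
        _ ≤ _ := by
            refine Nat.cast_le.mpr (Finset.card_le_card_of_injOn (Fin.append u) ?_ ?_)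
            · intro v hv
              simp only [Finset.coe_filter, lastWords, headWords, words, Finset.mem_filter,
                Finset.mem_univ, true_and, Set.mem_ofPred_eq] at hu hv ⊢
              rw [wordProd_append, List.ofFn_fin_append, List.head?_append, List.getLast?_append,
                hu, hv.1]
              exact ⟨⟨rfl, rfl⟩, hv.2⟩
            · intro v _ v' _ h
              ext1 i
              simpa [Fin.append_right] using congrFun h (Fin.natAdd m i)
    have h2 : levelWeight c t n ≤ 1 * (4 * t) ^ m * levelWeight c t (n + m) :=
      levelWeight_le ht (by rw [one_mul]; exact hm (by omega))
    rw [one_mul] at h2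
    rw [add_comm m n] at hcount
    calc _ ≤ ((4 * t) ^ m * levelWeight c t (n + m)) * endCount (n + m) A a 1 :=
          mul_le_mul h2 hcount (Finset.sum_nonneg fun v _ => closedIndicator_nonneg z E u v)
            ((levelWeight_pos hc ht n).le.trans h2)
      _ = _ := by ring
  have hS : 0 ≤ singleSeries A a c t := Real.iSup_nonneg fun N => by
    rw [integrate_eq]; exact density_nonneg A a hc N ht 1
  have hcard : ((headWords m A).card : ℝ) ≤ 4 ^ m := by
    have := Finset.card_le_univ (headWords m A)
    simp only [Fintype.card_pi, Finset.prod_const, Finset.card_univ, Fintype.card_fin] at this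
    calc _ ≤ ((Fintype.card Letter ^ m : ℕ) : ℝ) := Nat.cast_le.mpr this
      _ = _ := by simp
  calc _ ≤ levelWeight c t m * (4 ^ m * ((4 * t) ^ m * singleSeries A a c t)) := by
        refine mul_le_mul_of_nonneg_left ?_ (levelWeight_pos hc ht m).le
        refine (Finset.sum_le_sum hfix).trans ?_
        rw [Finset.sum_const, nsmul_eq_mul]
        exact mul_le_mul_of_nonneg_right hcard (by positivity)
    _ = _ := by
        -- All powers of `t` cancel, so the prefactor stays fixed as `t` approaches the critical
        -- value.
        have := levelWeight_add c ht 0 m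
        simp only [zero_add, pow_zero, inv_one, one_mul, mul_one] at this
        rw [← this]; ring

/-- The event that the word on the coordinates `-ℓ, …, -1` has product of length at least `q`. -/
def longEvent (ℓ q : ℕ) : Set Shift := {y | q ≤ (backwardProd y ℓ).norm}

/-- The mass of the words `u` that end in a long word of length `ℓ`. -/
lemma sum_levelMass_le {c : ℕ → ℝ} (hc : ∀ n, 0 < c n) (A a : Letter) (z : Shift) (N : ℕ) {t : ℝ}
    (ht : 0 < t) (ℓ q : ℕ) :
    ∑ m ∈ Finset.Icc 1 N, levelWeight c t m * levelMass A a c z N t (longEvent ℓ q) (m + ℓ) ≤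
      4 * (ℓ + 1) ^ 2 * 4 ^ ℓ * (√3)⁻¹ ^ q *
        ∑ g ∈ walkRange N, freeDensity c N t g ^ 2 := by
  refine le_trans ?_ (sum_long_words_le ℓ q (walkRange N) (freeDensity c N t)
    (freeDensity_nonneg hc N ht) fun g hg => freeDensity_eq_zero c t hg)
  have hmass : ∀ m, levelMass A a c z N t (longEvent ℓ q) (m + ℓ) ≤
      ∑ u : Fin m → Letter, ∑ w : Fin ℓ → Letter,
        if q ≤ (wordProd w).norm then freeDensity c N t (wordProd u * wordProd w) else 0 := by
    intro m
    have hsum := sum_append (m := m) (fun w' : Fin (m + ℓ) → Letter =>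
      if q ≤ (wordProd fun i : Fin ℓ => w' (Fin.natAdd m i)).norm
        then freeDensity c N t (wordProd w') else 0)
    simp only [Fin.append_right, wordProd_append] at hsum
    rw [← hsum]
    unfold levelMass
    refine (Finset.sum_le_sum_of_subset_of_nonneg (Finset.filter_subset _ _) fun u _ _ =>
      Finset.sum_nonneg fun n _ => mul_nonneg (levelWeight_pos hc ht n).le
      (Finset.sum_nonneg fun v _ => closedIndicator_nonneg z _ u v)).trans ?_
    refine Finset.sum_le_sum fun u' _ => ?_
    obtain ⟨⟨u, w⟩, rfl⟩ := (Fin.appendEquiv (α := Letter) m ℓ).surjective u'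
    change ∑ n ∈ Finset.Icc 1 N, levelWeight c t n * ∑ v ∈ lastWords n a,
      closedIndicator z (longEvent ℓ q) (Fin.append u w) v ≤
      if q ≤ (wordProd fun i : Fin ℓ => Fin.append u w (Fin.natAdd m i)).norm then
        freeDensity c N t (wordProd (Fin.append u w)) else 0
    simp only [Fin.append_right]
    split_ifs with hq
    -- Closing up forces `v` to represent the inverse of the product of `u w`; symmetry then removes
    -- the inverse.
    · rw [← freeDensity_inv]
      refine Finset.sum_le_sum fun n _ => ?_
      refine mul_le_mul_of_nonneg_left ?_ (levelWeight_pos hc ht n).le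
      rw [wordCount_eq_sum]
      refine (Finset.sum_le_sum_of_subset_of_nonneg (Finset.filter_subset _ _) fun v _ _ =>
        closedIndicator_nonneg z _ _ v).trans (Finset.sum_le_sum fun v _ => ?_)
      refine (closedIndicator_le ..).trans (le_of_eq ?_)
      congr 1
      rw [eq_comm (a := wordProd v), inv_eq_iff_mul_eq_one]
    · refine le_of_eq (Finset.sum_eq_zero fun n _ => ?_)
      rw [Finset.sum_eq_zero, mul_zero]
      intro v _
      rw [closedIndicator, Set.indicator_of_notMem, mul_zero]
      simpa [longEvent, backwardProd_insertWords] using hq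
  calc _ ≤ ∑ m ∈ Finset.Icc 1 N, levelWeight c t m * ∑ u : Fin m → Letter, ∑ w : Fin ℓ → Letter,
        (if q ≤ (wordProd w).norm then freeDensity c N t (wordProd u * wordProd w) else 0) :=
        Finset.sum_le_sum fun m _ => mul_le_mul_of_nonneg_left (hmass m)
          (levelWeight_pos hc ht m).le
    -- Grouping the words `u` by their product `g` turns the sum over `m` into a second copy of the
    -- density, hence an autocorrelation.
    _ = ∑ m ∈ Finset.Icc 1 N, ∑ w : Fin ℓ → Letter, if q ≤ (wordProd w).norm then
        ∑ g ∈ walkRange N, levelWeight c t m * wordCount m g *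
          freeDensity c N t (g * wordProd w) else 0 := by
        refine Finset.sum_congr rfl fun m hm => ?_
        rw [Finset.sum_comm, Finset.mul_sum]
        refine Finset.sum_congr rfl fun w _ => ?_
        split_ifs
        · rw [sum_wordProd_eq (fun u => wordProd_mem_walkRange hm u)
            (fun g => freeDensity c N t (g * wordProd w)), Finset.mul_sum]
          exact Finset.sum_congr rfl fun g _ => by ring
        · simp
    _ = _ := by
        rw [Finset.sum_comm]
        refine Finset.sum_congr rfl fun w _ => ?_
        split_ifs
        · rw [Finset.sum_comm]
          refine Finset.sum_congr rfl fun g _ => ?_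
          rw [← Finset.sum_mul]; rfl
        · simp

/-! ### Borel–Cantelli -/

lemma ae_eventually_notMem_of_summable {Ω : Type*} [MeasurableSpace Ω] (μ : Measure Ω)
    [IsFiniteMeasure μ] {E : ℕ → Set Ω} {b : ℕ → ℝ} (hb : Summable b)
    (h : ∀ n, μ.real (E n) ≤ b n) : ∀ᵐ x ∂μ, ∀ᶠ n in atTop, x ∉ E n := by
  refine ae_eventually_notMem ?_
  have hs : Summable fun n => μ.real (E n) :=
    Summable.of_nonneg_of_le (fun _ => measureReal_nonneg) h hb
  have : ∀ n, μ (E n) = ENNReal.ofReal (μ.real (E n)) := fun n => by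
    rw [ofReal_measureReal]
  simp only [this]
  exact hs.tsum_ofReal_ne_top

/-! ### The drift of the simple random walk -/

instance : IsProbabilityMeasure walkMeasure := by
  unfold walkMeasure; infer_instance

/-- The word on the coordinates `-n, …, -1`. -/
def backwardWord (n : ℕ) (x : Shift) : Fin n → Letter := fun i => x ((i : ℤ) - n)

lemma walkMeasure_backwardWord {n : ℕ} (w : Fin n → Letter) :
    walkMeasure.real {x | backwardWord n x = w} = (1 / 4) ^ n := by
  classical
  let s : Finset ℤ := Finset.univ.image fun i : Fin n => (i : ℤ) - n
  have hinj : Function.Injective fun i : Fin n => (i : ℤ) - n := by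
    intro i j h
    ext
    simpa using h
  let y : ℤ → Letter := fun j => if h : 0 ≤ j + n ∧ j < 0 then w ⟨(j + n).toNat, by omega⟩ else (0, true)
  have hy : ∀ i : Fin n, y ((i : ℤ) - n) = w i := by
    intro i
    have := i.2
    simp only [y]
    rw [dif_pos (by omega)]
    congr 1
    ext
    simp
  have hset : {x | backwardWord n x = w} = Set.pi s fun j => {y j} := by
    ext x
    simp only [Set.mem_ofPred_eq, Set.mem_pi, Finset.mem_coe, Set.mem_singleton_iff, s,
      Finset.mem_image, Finset.mem_univ, true_and, forall_exists_index, forall_apply_eq_imp_iff, hy]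
    exact funext_iff
  rw [hset, Measure.real, walkMeasure, Measure.infinitePi_pi _ fun _ _ => measurableSet_singleton _]
  simp only [PMF.toMeasure_apply_singleton _ _ (measurableSet_singleton _),
    PMF.uniformOfFintype_apply, Finset.prod_const]
  rw [Finset.card_image_of_injective _ hinj]
  simp

lemma walkMeasure_le (n : ℕ) (p : F2 → Prop) [DecidablePred p] :
    walkMeasure.real {x | p (backwardProd x n)} ≤
      (1 / 4) ^ n * ∑ w : Fin n → Letter, if p (wordProd w) then (1 : ℝ) else 0 := by
  have hsub : {x | p (backwardProd x n)} ⊆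
      ⋃ w ∈ Finset.univ.filter fun w : Fin n → Letter => p (wordProd w),
        {x | backwardWord n x = w} := by
    intro x hx
    simp only [Finset.mem_filter, Finset.mem_univ, true_and, Set.mem_iUnion, Set.mem_ofPred_eq]
    exact ⟨backwardWord n x, hx, rfl⟩
  refine (measureReal_mono hsub (measure_ne_top _ _)).trans ((measureReal_biUnion_finset_le _ _).trans ?_)
  simp [walkMeasure_backwardWord, mul_comm]

/-- From `exp x ≤ 1 + x + x²` for `|x| ≤ 1`, the left side is at most `4 (1 + s/2 + s²)`. The slope
`1/2` is the drift. -/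
lemma exp_step_le {s : ℝ} (hs : |s| ≤ 1) :
    Real.exp (-s) + 3 * Real.exp s ≤ 4 * Real.exp (s / 2 + s ^ 2) := by
  have h1 := Real.abs_exp_sub_one_sub_id_le hs
  have h2 := Real.abs_exp_sub_one_sub_id_le (x := -s) (by rwa [abs_neg])
  have h3 := Real.add_one_le_exp (s / 2 + s ^ 2)
  have := (abs_le.mp h1).2
  have := (abs_le.mp h2).2
  nlinarith

/-- For `s > 0` the exponential alone can fail at the identity, where every step goes outward. The
added term is harmonic elsewhere and drops at the identity, which compensates; `h0` is exactly the
inequality there. -/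
lemma exp_supersolution {s : ℝ} (hs : |s| ≤ 1) {a : ℝ} (ha : 0 ≤ a)
    (h1 : a = 0 ∨ 0 ≤ s)
    (h0 : Real.exp s + a / 3 ≤ Real.exp (s / 2 + s ^ 2) * (1 + a)) (g : F2) :
    ∑ l, (Real.exp (s * (skew l * g).norm) + a * (1 / 3) ^ (skew l * g).norm) ≤
      4 * Real.exp (s / 2 + s ^ 2) * (Real.exp (s * g.norm) + a * (1 / 3) ^ g.norm) := by
  by_cases hg : g = 1
  · subst hg
    rw [sum_norm_skew_mul_one fun k => Real.exp (s * k) + a * (1 / 3) ^ k]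
    simp only [FreeGroup.norm_one, Nat.cast_zero, mul_zero, Real.exp_zero, pow_zero, pow_one,
      Nat.cast_one, mul_one]
    linarith
  · rw [sum_norm_skew_mul hg fun k => Real.exp (s * k) + a * (1 / 3) ^ k]
    have hk : g.norm ≠ 0 := fun h => hg (FreeGroup.norm_eq_zero.mp h)
    obtain ⟨k, hk⟩ := Nat.exists_eq_succ_of_ne_zero hk
    rw [hk]
    simp only [Nat.succ_eq_add_one, Nat.add_sub_cancel]
    have e1 : Real.exp (s * k) = Real.exp (-s) * Real.exp (s * (k + 1 : ℕ)) := by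
      rw [← Real.exp_add]; congr 1; push_cast; ring
    have e2 : Real.exp (s * (k + 1 + 1 : ℕ)) = Real.exp s * Real.exp (s * (k + 1 : ℕ)) := by
      rw [← Real.exp_add]; congr 1; push_cast; ring
    have h2 := mul_le_mul_of_nonneg_right (exp_step_le hs) (Real.exp_pos (s * (k + 1 : ℕ))).le
    have h3 : a * (1 / 3 : ℝ) ^ k + 3 * (a * (1 / 3) ^ (k + 1 + 1)) ≤
        4 * Real.exp (s / 2 + s ^ 2) * (a * (1 / 3) ^ (k + 1)) := by
      rcases h1 with rfl | h1
      · simp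
      · have : 1 ≤ Real.exp (s / 2 + s ^ 2) := Real.one_le_exp (by positivity)
        calc _ = 4 * 1 * (a * (1 / 3) ^ (k + 1)) := by rw [pow_succ, pow_succ]; ring
          _ ≤ _ := by gcongr
    rw [e1, e2]
    linarith

/-- Large deviations of the word length from half the number of steps. -/
lemma walkMeasure_deviation_le {ε : ℝ} (hε : 0 < ε) (hε1 : ε ≤ 1) (n : ℕ) :
    walkMeasure.real {x | ε * n ≤ |((backwardProd x n).norm : ℝ) - n / 2|} ≤
      (2 + 2 * Real.exp 1) * Real.exp (-(ε ^ 2 / 4)) ^ n := by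
  refine (walkMeasure_le n fun g => ε * n ≤ |(g.norm : ℝ) - n / 2|).trans ?_
  -- The exponent `ε / 2` maximises `s ε - s²`, giving the rate `ε² / 4`; its negative serves the
  -- lower tail.
  have hs1 : |ε / 2| ≤ 1 := by rw [abs_of_pos (by positivity)]; linarith
  have hs2 : |-(ε / 2)| ≤ 1 := by rwa [abs_neg]
  have he : Real.exp (ε / 2) ≤ Real.exp 1 := Real.exp_le_exp.mpr (by linarith)
  have hup0 : Real.exp (ε / 2) + 2 * Real.exp (ε / 2) / 3 ≤
      Real.exp (ε / 2 / 2 + (ε / 2) ^ 2) * (1 + 2 * Real.exp (ε / 2)) := by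
    have : 1 ≤ Real.exp (ε / 2 / 2 + (ε / 2) ^ 2) := Real.one_le_exp (by positivity)
    have := Real.exp_pos (ε / 2)
    nlinarith
  have hdn0 : Real.exp (-(ε / 2)) + 0 / 3 ≤
      Real.exp (-(ε / 2) / 2 + (-(ε / 2)) ^ 2) * (1 + 0) := by
    rw [zero_div, add_zero, add_zero, mul_one]
    exact Real.exp_le_exp.mpr (by nlinarith)
  have up := sum_wordProd_le
    (u := fun g => Real.exp (ε / 2 * g.norm) + 2 * Real.exp (ε / 2) * (1 / 3) ^ g.norm)
    (by positivity)
    (exp_supersolution hs1 (by positivity) (Or.inr (by positivity)) hup0) n 1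
  have dn := sum_wordProd_le
    (u := fun g => Real.exp (-(ε / 2) * g.norm) + 0 * (1 / 3) ^ g.norm) (by positivity)
    (exp_supersolution hs2 le_rfl (Or.inl rfl) hdn0) n 1
  simp only [mul_one, FreeGroup.norm_one, Nat.cast_zero, mul_zero, Real.exp_zero, pow_zero,
    zero_mul, add_zero] at up dn
  set D := Real.exp (-(ε ^ 2 / 4))
  have hup : (1 / 4 : ℝ) ^ n * (Real.exp (-(ε / 2 * (1 / 2 + ε) * n)) *
      (4 * Real.exp (ε / 2 / 2 + (ε / 2) ^ 2)) ^ n) = D ^ n := by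
    rw [mul_pow, ← Real.exp_nat_mul, ← Real.exp_nat_mul, mul_left_comm, ← mul_assoc ((1 / 4) ^ n),
      ← mul_pow]
    norm_num
    rw [← Real.exp_add]
    congr 1; ring
  have hdn : (1 / 4 : ℝ) ^ n * (Real.exp (ε / 2 * (1 / 2 - ε) * n) *
      (4 * Real.exp (-(ε / 2) / 2 + (-(ε / 2)) ^ 2)) ^ n) = D ^ n := by
    rw [mul_pow, ← Real.exp_nat_mul, ← Real.exp_nat_mul, mul_left_comm, ← mul_assoc ((1 / 4) ^ n),
      ← mul_pow]
    norm_num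
    rw [← Real.exp_add]
    congr 1; ring
  have hD : 0 < D := Real.exp_pos _
  calc _ ≤ (1 / 4) ^ n * ∑ w : Fin n → Letter,
        (Real.exp (-(ε / 2 * (1 / 2 + ε) * n)) * (Real.exp (ε / 2 * (wordProd w).norm) +
          2 * Real.exp (ε / 2) * (1 / 3) ^ (wordProd w).norm) +
        Real.exp (ε / 2 * (1 / 2 - ε) * n) * Real.exp (-(ε / 2) * (wordProd w).norm)) := by
        refine mul_le_mul_of_nonneg_left (Finset.sum_le_sum fun w _ => ?_) (by positivity)
        split_ifs with h
        · rcases le_abs.mp h with h | h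
          · have : 1 ≤ Real.exp (-(ε / 2 * (1 / 2 + ε) * n)) *
                Real.exp (ε / 2 * (wordProd w).norm) := by
              rw [← Real.exp_add]
              exact Real.one_le_exp (by nlinarith)
            have : 0 ≤ Real.exp (-(ε / 2 * (1 / 2 + ε) * n)) *
              (2 * Real.exp (ε / 2) * (1 / 3) ^ (wordProd w).norm) := by positivity
            have : 0 ≤ Real.exp (ε / 2 * (1 / 2 - ε) * n) *
              Real.exp (-(ε / 2) * (wordProd w).norm) := by positivity
            linarith
          · have : 1 ≤ Real.exp (ε / 2 * (1 / 2 - ε) * n) *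
                Real.exp (-(ε / 2) * (wordProd w).norm) := by
              rw [← Real.exp_add]
              exact Real.one_le_exp (by nlinarith)
            have : 0 ≤ Real.exp (-(ε / 2 * (1 / 2 + ε) * n)) *
              (Real.exp (ε / 2 * (wordProd w).norm) +
                2 * Real.exp (ε / 2) * (1 / 3) ^ (wordProd w).norm) := by positivity
            linarith
        · positivity
    _ ≤ (1 / 4) ^ n * (Real.exp (-(ε / 2 * (1 / 2 + ε) * n)) *
          ((4 * Real.exp (ε / 2 / 2 + (ε / 2) ^ 2)) ^ n * (1 + 2 * Real.exp (ε / 2))) +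
        Real.exp (ε / 2 * (1 / 2 - ε) * n) *
          (4 * Real.exp (-(ε / 2) / 2 + (-(ε / 2)) ^ 2)) ^ n) := by
        rw [Finset.sum_add_distrib, ← Finset.mul_sum, ← Finset.mul_sum]
        gcongr
    _ = D ^ n * (1 + 2 * Real.exp (ε / 2)) + D ^ n := by
        rw [mul_add, hdn]
        congr 1
        rw [← hup]; ring
    _ ≤ D ^ n * (1 + 2 * Real.exp 1) + D ^ n := by gcongr
    _ = _ := by ring

/-- The simple random walk has drift `1/2`. -/
theorem walkMeasure_drift : ∀ᵐ x ∂walkMeasure,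
    Tendsto (fun n : ℕ => ((backwardProd x n).norm : ℝ) / (n : ℝ)) atTop (𝓝 (1 / 2)) := by
  have hj : ∀ j : ℕ, ∀ᵐ x ∂walkMeasure, ∀ᶠ n : ℕ in atTop,
      |((backwardProd x n).norm : ℝ) - n / 2| < 1 / ((j : ℝ) + 1) * n := by
    intro j
    have hε : (0 : ℝ) < 1 / ((j : ℝ) + 1) := by positivity
    have hε1 : 1 / ((j : ℝ) + 1) ≤ 1 := by
      rw [div_le_one (by positivity)]
      linarith [(Nat.cast_nonneg j : (0 : ℝ) ≤ j)]
    have hr : Real.exp (-((1 / ((j : ℝ) + 1)) ^ 2 / 4)) < 1 := by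
      rw [Real.exp_lt_one_iff]
      have : 0 < (1 / ((j : ℝ) + 1)) ^ 2 / 4 := by positivity
      linarith
    have := ae_eventually_notMem_of_summable walkMeasure
      ((summable_geometric_of_lt_one (Real.exp_pos _).le hr).mul_left _)
      (walkMeasure_deviation_le hε hε1)
    filter_upwards [this] with x hx
    filter_upwards [hx] with n hn
    simpa using hn
  rw [← ae_all_iff] at hj
  filter_upwards [hj] with x hx
  rw [Metric.tendsto_nhds]
  intro ε hε
  obtain ⟨j, hj⟩ := exists_nat_one_div_lt hε
  filter_upwards [hx j, eventually_gt_atTop 0] with n hn hn0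
  have hn' : (0 : ℝ) < n := by exact_mod_cast hn0
  rw [Real.dist_eq]
  have : ((backwardProd x n).norm : ℝ) / n - 1 / 2 = ((backwardProd x n).norm - n / 2) / n := by
    field_simp
  rw [this, abs_div, abs_of_pos hn', div_lt_iff₀ hn']
  exact hn.trans (mul_lt_mul_of_pos_right hj hn')

/-! ### Weak limits -/

lemma isClopen_longEvent (ℓ q : ℕ) : IsClopen (longEvent ℓ q) := by
  have hc : Continuous (backwardWord ℓ) := continuous_pi fun i => continuous_apply _
  exact (isClopen_discrete {w : Fin ℓ → Letter | q ≤ (wordProd w).norm}).preimage hc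

/-- The indicator of a clopen set is a bounded continuous test function. -/
lemma tendsto_apply_of_isClopen {ι : Type*} {L : Filter ι} {ν : ι → FiniteMeasure Shift}
    {μ : FiniteMeasure Shift} (h : Tendsto ν L (𝓝 μ)) {E : Set Shift} (hE : IsClopen E) :
    Tendsto (fun i => ((ν i E : NNReal) : ℝ)) L (𝓝 (μ E : ℝ)) := by
  have h1 := FiniteMeasure.tendsto_iff_forall_integral_tendsto.mp h
    (BoundedContinuousFunction.indicator E hE)
  have : ∀ μ : FiniteMeasure Shift,
      ∫ x, BoundedContinuousFunction.indicator E hE x ∂(μ : Measure Shift) = (μ E : ℝ) := by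
    intro μ
    exact integral_indicator_one hE.isOpen.measurableSet
  simpa only [this] using h1

/-! ### Slowly increasing weights and the normalising factors -/

/-- The ratio over `ℓ` steps is a product of `ℓ` ratios tending to `1`; the constant `2` is any
number above `1`. -/
lemma SlowlyIncreasing.eventually_le {c : ℕ → ℝ} (hc : SlowlyIncreasing c) (ℓ : ℕ) :
    ∃ M, ∀ m, M ≤ m → c (m + ℓ) ≤ 2 * c m := by
  have h : Tendsto (fun m => c (m + ℓ) / c m) atTop (𝓝 1) := by
    induction ℓ with
    | zero =>
      refine tendsto_const_nhds.congr fun m => ?_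
      rw [add_zero, div_self (hc.pos m).ne']
    | succ ℓ ih =>
      have h2 := (hc.ratio.comp (tendsto_add_atTop_nat ℓ)).mul ih
      rw [one_mul] at h2
      refine h2.congr fun m => ?_
      have := (hc.pos (m + ℓ)).ne'
      simp only [Function.comp_apply, ← add_assoc]
      field_simp
  obtain ⟨M, hM⟩ := eventually_atTop.mp (h.eventually_lt_const (by norm_num : (1 : ℝ) < 2))
  exact ⟨M, fun m hm => ((div_lt_iff₀ (hc.pos m)).mp (hM m hm)).le⟩

/-- A real supremum over an unbounded family defaults to `0`, so positivity certifies boundedness.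
-/
lemma bddAbove_of_iSup_pos {f : ℕ → ℝ} (h : 0 < ⨆ n, f n) : BddAbove (Set.range f) := by
  by_contra hb
  rw [Real.iSup_of_not_bddAbove hb] at h
  exact lt_irrefl _ h

/-! ### Mass of long events -/

/-- A bound for the approximating measures of long events, uniform in the truncation. -/
lemma approxMeasure_longEvent_le (A a : Letter) {c : ℕ → ℝ} (hc : SlowlyIncreasing c) (z : Shift)
    (ℓ q : ℕ) : ∃ K : ℝ, ∀ (N : ℕ) (t : ℝ), 0 < t → 0 < normFactor A a c t →
      0 < singleSeries A a c t →
      (approxMeasure A a c z N t (longEvent ℓ q) : ℝ) ≤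
        K * (normFactor A a c t / singleSeries A a c t)⁻¹ +
          8 * (4 * t) ^ 8 * (ℓ + 1) ^ 2 * (t ^ ℓ)⁻¹ * (√3)⁻¹ ^ q := by
  obtain ⟨M, hM⟩ := hc.eventually_le ℓ
  -- The constant collects the finitely many lengths of `u` below which `c` may still grow by more
  -- than a factor `2`; it depends neither on `N` nor on `t`.
  refine ⟨∑ m ∈ Finset.Icc 1 (M + ℓ), c m * 4 ^ m, fun N t ht hF hS => ?_⟩
  have hbF := bddAbove_of_iSup_pos hF
  have hbS := bddAbove_of_iSup_pos hS
  refine (approxMeasure_le A a hc.pos z N ht hF (isClopen_longEvent ℓ q).isOpen.measurableSet).trans ?_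
  rw [div_le_iff₀ hF]
  set F := normFactor A a c t
  set f : ℕ → ℝ := fun m => levelWeight c t m * levelMass A a c z N t (longEvent ℓ q) m
  have hf : ∀ m, 0 ≤ f m := fun m =>
    mul_nonneg (levelWeight_pos hc.pos ht m).le (levelMass_nonneg A a hc.pos z N ht _ m)
  have hshort : ∑ m ∈ Finset.Icc 1 (M + ℓ), f m ≤
      (∑ m ∈ Finset.Icc 1 (M + ℓ), c m * 4 ^ m) * singleSeries A a c t := by
    rw [Finset.sum_mul]
    exact Finset.sum_le_sum fun m _ =>
      levelWeight_mul_levelMass_le A a hc.pos hc.mono z N ht hbS _ m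
  have hlong : ∑ m ∈ (Finset.Icc 1 N).filter (M ≤ ·), f (m + ℓ) ≤
      8 * (4 * t) ^ 8 * (ℓ + 1) ^ 2 * (t ^ ℓ)⁻¹ * (√3)⁻¹ ^ q * F := by
    have h1 : ∀ m ∈ (Finset.Icc 1 N).filter (M ≤ ·), f (m + ℓ) ≤ 2 * ((4 * t) ^ ℓ)⁻¹ *
        (levelWeight c t m * levelMass A a c z N t (longEvent ℓ q) (m + ℓ)) := by
      intro m hm
      have h2 := hM m (Finset.mem_filter.mp hm).2
      have h3 : levelWeight c t (m + ℓ) ≤ 2 * ((4 * t) ^ ℓ)⁻¹ * levelWeight c t m := by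
        have h4 : (4 * t) ^ ℓ * levelWeight c t (m + ℓ) ≤ 2 * levelWeight c t m := by
          rw [levelWeight_add c ht, levelWeight]
          calc _ ≤ (t ^ m)⁻¹ * (2 * c m) * (1 / 4) ^ m := by gcongr
            _ = _ := by ring
        calc _ = ((4 * t) ^ ℓ)⁻¹ * ((4 * t) ^ ℓ * levelWeight c t (m + ℓ)) := by field_simp
          _ ≤ ((4 * t) ^ ℓ)⁻¹ * (2 * levelWeight c t m) := by gcongr
          _ = _ := by ring
      rw [← mul_assoc]
      exact mul_le_mul_of_nonneg_right h3 (levelMass_nonneg A a hc.pos z N ht _ _)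
    calc _ ≤ ∑ m ∈ (Finset.Icc 1 N).filter (M ≤ ·), 2 * ((4 * t) ^ ℓ)⁻¹ *
        (levelWeight c t m * levelMass A a c z N t (longEvent ℓ q) (m + ℓ)) :=
          Finset.sum_le_sum h1
      _ ≤ 2 * ((4 * t) ^ ℓ)⁻¹ * ∑ m ∈ Finset.Icc 1 N,
        levelWeight c t m * levelMass A a c z N t (longEvent ℓ q) (m + ℓ) := by
          rw [← Finset.mul_sum]
          refine mul_le_mul_of_nonneg_left ?_ (by positivity)
          exact Finset.sum_le_sum_of_subset_of_nonneg (Finset.filter_subset _ _) fun m _ _ =>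
            mul_nonneg (levelWeight_pos hc.pos ht m).le (levelMass_nonneg A a hc.pos z N ht _ _)
      _ ≤ 2 * ((4 * t) ^ ℓ)⁻¹ * (4 * (ℓ + 1) ^ 2 * 4 ^ ℓ * (√3)⁻¹ ^ q * ((4 * t) ^ 8 * F)) := by
          refine mul_le_mul_of_nonneg_left ?_ (by positivity)
          refine (sum_levelMass_le hc.pos A a z N ht ℓ q).trans ?_
          refine mul_le_mul_of_nonneg_left ?_ (by positivity)
          exact sum_freeDensity_sq_le A a hc.pos hc.mono N ht hbF _
      _ = _ := by
          rw [mul_pow 4 t ℓ]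
          field_simp
          ring
  have hsplit : ∑ m ∈ Finset.Icc 1 N, f m ≤ ∑ m ∈ Finset.Icc 1 (M + ℓ), f m +
      ∑ m ∈ (Finset.Icc 1 N).filter (M ≤ ·), f (m + ℓ) := by
    rw [← Finset.sum_image (f := f) (g := fun m => m + ℓ)
      (fun a _ b _ h => Nat.add_right_cancel h), ← Finset.sum_union_inter]
    refine (Finset.sum_le_sum_of_subset_of_nonneg ?_ fun m _ _ => hf m).trans
      (le_add_of_nonneg_right (Finset.sum_nonneg fun m _ => hf m))
    intro m hm
    simp only [Finset.mem_Icc, Finset.mem_union, Finset.mem_image, Finset.mem_filter] at hm ⊢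
    by_cases h : m ≤ M + ℓ
    · exact Or.inl ⟨hm.1, h⟩
    · exact Or.inr ⟨m - ℓ, by omega, by omega⟩
  refine hsplit.trans ((add_le_add hshort hlong).trans (le_of_eq ?_))
  rw [add_mul, inv_div]
  field_simp

/-- Twisted measures of long events. -/
lemma IsTwistedMeasure.longEvent_le {A a : Letter} {c : ℕ → ℝ} {z : Shift}
    {μ : FiniteMeasure Shift} (h : IsTwistedMeasure A a c z μ) (ℓ q : ℕ) :
    (μ (longEvent ℓ q) : ℝ) ≤
      8 * (4 * (criticalParam A a + 1)) ^ 8 * (ℓ + 1) ^ 2 * ((√3 / 2) ^ ℓ)⁻¹ * (√3)⁻¹ ^ q := by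
  obtain ⟨hadm, -, t, ν, ht, htlim, hν, hμ⟩ := h
  have hγ := sqrt_three_div_two_le_criticalParam A a
  have h3 : (0 : ℝ) < √3 / 2 := by positivity
  have htw : Tendsto t atTop (𝓝[>] criticalParam A a) :=
    tendsto_nhdsWithin_iff.mpr ⟨htlim, Eventually.of_forall ht⟩
  have hF := (hadm.diverges.comp htw).eventually_gt_atTop 0
  have hFS := hadm.dominates.comp htw
  have hE := isClopen_longEvent ℓ q
  obtain ⟨K, hK⟩ := approxMeasure_longEvent_le A a hadm.slow z ℓ q
  set b := 8 * (4 * (criticalParam A a + 1)) ^ 8 * (ℓ + 1) ^ 2 * ((√3 / 2) ^ ℓ)⁻¹ * (√3)⁻¹ ^ q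
  have hlim : Tendsto (fun k => K * (normFactor A a c (t k) / singleSeries A a c (t k))⁻¹ + b)
      atTop (𝓝 (K * 0 + b)) :=
    (hFS.inv_tendsto_atTop.const_mul K).add tendsto_const_nhds
  -- The short words disappear here, because the normalising factor dominates the single series.
  rw [mul_zero, zero_add] at hlim
  refine le_of_tendsto_of_tendsto (tendsto_apply_of_isClopen hμ hE) hlim ?_
  filter_upwards [hF, hFS.eventually_gt_atTop 0,
    htlim.eventually_lt_const (lt_add_one _)] with k hFk hSk htk
  have ht0 : √3 / 2 ≤ t k := hγ.trans (ht k).le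
  have htpos : 0 < t k := h3.trans_le ht0
  -- A zero denominator would make the quotient `0`, so divergence of the ratio also yields
  -- positivity.
  have hS : 0 < singleSeries A a c (t k) := (div_pos_iff_of_pos_left hFk).mp hSk
  refine le_of_tendsto' (tendsto_apply_of_isClopen (hν k) hE) fun N => ?_
  refine (hK N (t k) htpos hFk hS).trans (add_le_add_right ?_ _)
  simp only [b]
  gcongr

/-! ### The almost sure growth bound -/

lemma summable_sq_mul_pow {r : ℝ} (hr0 : 0 < r) (hr : r < 1) (C : ℝ) :
    Summable fun n : ℕ => C * ((n + 1 : ℝ) ^ 2 * r ^ n) := by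
  refine Summable.mul_left _ ?_
  have h := summable_pow_mul_geometric_of_norm_lt_one 2 (r := r)
    (by rwa [Real.norm_eq_abs, abs_of_pos hr0])
  have h2 := ((summable_nat_add_iff 1).mpr h).mul_right r⁻¹
  refine h2.congr fun n => ?_
  push_cast
  rw [pow_succ r n]
  field_simp

theorem IsTwistedMeasure.limsup_le {A a : Letter} {c : ℕ → ℝ} {z : Shift}
    {μ : FiniteMeasure Shift} (h : IsTwistedMeasure A a c z μ) :
    ∀ᵐ x ∂(μ : Measure Shift),
      limsup (fun n : ℕ => ((backwardProd x n).norm : ℝ) / (n : ℝ)) atTop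
        ≤ (2 * Real.log 2 - Real.log 3) / Real.log 3 := by
  set β₀ := (2 * Real.log 2 - Real.log 3) / Real.log 3 with hβ₀
  have hl3 : 0 < Real.log 3 := Real.log_pos (by norm_num)
  have key : ∀ j : ℕ, ∀ᵐ x ∂(μ : Measure Shift), ∀ᶠ n : ℕ in atTop,
      ((backwardProd x n).norm : ℝ) / n ≤ β₀ + 1 / ((j : ℝ) + 1) := by
    intro j
    set β := β₀ + 1 / ((j : ℝ) + 1) with hβ
    have hββ : β₀ < β := by
      have : (0 : ℝ) < 1 / ((j : ℝ) + 1) := by positivity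
      linarith
    -- This is `(2/√3) 3^{-β/2}`, the rate of the long-event bound at `q = βn`; it is below `1`
    -- exactly when `β` exceeds `β₀`.
    set r := Real.exp (Real.log 2 - Real.log 3 / 2 - β * Real.log 3 / 2) with hr
    have hr1 : r < 1 := by
      rw [hr, Real.exp_lt_one_iff]
      have : 2 * Real.log 2 - Real.log 3 < β * Real.log 3 := by
        rwa [hβ₀, div_lt_iff₀ hl3] at hββ
      linarith
    have hsqrt : √3 = Real.exp (Real.log 3 / 2) := by
      rw [Real.exp_half, Real.exp_log (by norm_num)]
    have hb : ∀ n : ℕ, (μ : Measure Shift).real (longEvent n ⌈β * n⌉₊) ≤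
        8 * (4 * (criticalParam A a + 1)) ^ 8 * ((n + 1 : ℝ) ^ 2 * r ^ n) := by
      intro n
      refine (h.longEvent_le n ⌈β * n⌉₊).trans ?_
      have hγ := sqrt_three_div_two_le_criticalParam A a
      have hγ0 : 0 ≤ criticalParam A a := le_trans (by positivity) hγ
      rw [mul_assoc, mul_assoc, ← mul_assoc ((n + 1 : ℝ) ^ 2), mul_assoc ((n + 1 : ℝ) ^ 2)]
      refine mul_le_mul_of_nonneg_left ?_ (by positivity)
      refine mul_le_mul_of_nonneg_left ?_ (by positivity)
      have e1 : ((√3 / 2) ^ n)⁻¹ = Real.exp (n * (Real.log 2 - Real.log 3 / 2)) := by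
        rw [Real.exp_nat_mul, Real.exp_sub, Real.exp_log (by norm_num), ← hsqrt, ← inv_pow, inv_div]
      have e2 : (√3)⁻¹ ^ ⌈β * n⌉₊ ≤ Real.exp (-(β * n * (Real.log 3 / 2))) := by
        rw [hsqrt, ← Real.exp_neg, ← Real.exp_nat_mul]
        refine Real.exp_le_exp.mpr ?_
        have := mul_le_mul_of_nonneg_right (Nat.le_ceil (β * n)) (half_pos hl3).le
        linarith
      rw [e1]
      refine (mul_le_mul_of_nonneg_left e2 (Real.exp_pos _).le).trans (le_of_eq ?_)
      rw [← Real.exp_add, hr, ← Real.exp_nat_mul]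
      congr 1; ring
    have := ae_eventually_notMem_of_summable (μ : Measure Shift)
      (summable_sq_mul_pow (Real.exp_pos _) hr1 _) hb
    filter_upwards [this] with x hx
    filter_upwards [hx, eventually_gt_atTop 0] with n hn hn0
    have hn' : (0 : ℝ) < n := by exact_mod_cast hn0
    rw [div_le_iff₀ hn']
    simp only [longEvent, Set.mem_ofPred_eq, not_le] at hn
    exact (Nat.lt_ceil.mp hn).le
  rw [← ae_all_iff] at key
  filter_upwards [key] with x hx
  refine le_of_forall_pos_le_add fun ε hε => ?_
  obtain ⟨j, hj⟩ := exists_nat_one_div_lt hε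
  -- The real `limsup` is an infimum of eventual upper bounds; nonnegativity keeps that set bounded
  -- below.
  have hcob : IsCoboundedUnder (· ≤ ·) atTop
      fun n : ℕ => ((backwardProd x n).norm : ℝ) / (n : ℝ) :=
    (isBoundedUnder_of ⟨0, fun n => by positivity⟩ : IsBoundedUnder (· ≥ ·) atTop _).isCoboundedUnder_le
  exact (limsup_le_of_le hcob (hx j)).trans (by linarith)

/-- Equivalent to `2^4 < 3^3`. -/
lemma two_log_two_sub_log_three_lt :
    (2 * Real.log 2 - Real.log 3) / Real.log 3 < 1 / 2 := by
  have hl3 : 0 < Real.log 3 := Real.log_pos (by norm_num)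
  rw [div_lt_iff₀ hl3]
  have h : Real.log (2 ^ 4) < Real.log (3 ^ 3) := Real.log_lt_log (by norm_num) (by norm_num)
  rw [Real.log_pow, Real.log_pow] at h
  push_cast at h
  linarith

end FreeWalk

end

open FreeWalk
theorem mainTheorem11 :
    (∀ (A a : Letter) (c : ℕ → ℝ) (z : Shift) (μ : FiniteMeasure Shift),
      IsTwistedMeasure A a c z μ →
        ∀ᵐ x ∂(μ : Measure Shift),
          limsup (fun n : ℕ => ((backwardProd x n).norm : ℝ) / (n : ℝ)) atTop
            ≤ (2 * Real.log 2 - Real.log 3) / Real.log 3) ∧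
    (2 * Real.log 2 - Real.log 3) / Real.log 3 < 1 / 2 ∧
    (∀ᵐ x ∂walkMeasure,
      Tendsto (fun n : ℕ => ((backwardProd x n).norm : ℝ) / (n : ℝ)) atTop (𝓝 (1 / 2))) :=
  ⟨fun _ _ _ _ _ h => h.limsup_le, two_log_two_sub_log_three_lt, walkMeasure_drift⟩
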